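/- Let $\mathbb D$ be the open unit disk in $\mathbb C$, let $L^2(\mathbb D)$ be taken with respect to the normalised area measure on $\mathbb D$, let $B^2(\mathbb D)$ be the Bergman space, i.e. the closure in $L^2(\mathbb D)$ of the linear span of the functions $z^n$, $n\ge 0$, and let $P$ be the orthogonal projection of $L^2(\mathbb D)$ onto $B^2(\mathbb D)$. For $\varphi\in L^\infty(\mathbb D)$ the Toeplitz operator $T(\varphi)$ on $B^2(\mathbb D)$ is defined by $T(\varphi)f=P(\varphi f)$. For a compact operator $T$ on a Hilbert space, $s_0(T)\ge s_1(T)\ge\dots$ denotes the sequence of its singular values, i.e. of the eigenvalues of $|T|=\sqrt{T^*T}$, enumerated with multiplicities taken into account (and continued by $0$ if $T$ has finite rank). Theorem. Let $\varphi\in L^\infty(\mathbb D)$ and $\gamma>0$. Assume that for some continuous function $\varphi_\infty:\{|z|=1\}\to\mathbb C$ one has $$\sup_{0<\theta\le 2\pi}\bigl|(1-r)^{-\gamma}\varphi(re^{i\theta})-\varphi_\infty(e^{i\theta})\bigr|\to 0,\qquad r\to 1^-.$$ Then $T(\varphi)$ is compact, and its singular values satisfy $$s_n(T(\varphi))=C_\gamma(\varphi)\,n^{-\gamma}+o(n^{-\gamma}),\qquad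 n\to\infty,$$ where $$C_\gamma(\varphi)=2^{-\gamma}\,\Gamma(\gamma+1)\Bigl(\int_0^{2\pi}|\varphi_\infty(e^{i\theta})|^{1/\gamma}\,\frac{d\theta}{2\pi}\Bigr)^{\gamma}.$$ -/

import Mathlib

open MeasureTheory Filter Topology Asymptotics
open scoped ENNReal

noncomputable section

/-- The normalised Lebesgue area measure on the open unit disk, as a measure on `ℂ`. -/
def diskMeasure : Measure ℂ :=
  (ENNReal.ofReal Real.pi)⁻¹ • (volume : Measure ℂ).restrict (Metric.ball 0 1)

instance isProbabilityMeasure_diskMeasure : IsProbabilityMeasure diskMeasure where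
  measure_univ := by
    have h : ENNReal.ofReal Real.pi = (NNReal.pi : ℝ≥0∞) := by
      rw [← NNReal.coe_real_pi, ENNReal.ofReal_coe_nnreal]
    have h0 : (NNReal.pi : ℝ≥0∞) ≠ 0 := by
      simpa using NNReal.pi_ne_zero
    simp [diskMeasure, Complex.volume_ball, h, ENNReal.inv_mul_cancel h0 ENNReal.coe_ne_top]

/-- The Hilbert space `L²(𝔻)`. -/
abbrev L2Disk : Type := Lp ℂ 2 diskMeasure

lemma memLp_monomial (n : ℕ) : MemLp (fun z : ℂ => z ^ n) 2 diskMeasure := by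
  have hT : MemLp (fun z : ℂ => z ^ n) ∞ diskMeasure := by
    refine memLp_top_of_bound (by fun_prop) 1 ?_
    refine Measure.ae_smul_measure ?_ _
    filter_upwards [ae_restrict_mem measurableSet_ball] with z hz
    rw [norm_pow]
    exact pow_le_one₀ (norm_nonneg z) (le_of_lt (by simpa using hz))
  exact hT.mono_exponent le_top

/-- The function `zⁿ` as an element of `L²(𝔻)`. -/
def monomialL2 (n : ℕ) : L2Disk := (memLp_monomial n).toLp

/-- The Bergman space `B²(𝔻)`: the closure in `L²(𝔻)` of the linear span of the functions `zⁿ`. -/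
def bergmanSpace : Submodule ℂ L2Disk :=
  (Submodule.span ℂ (Set.range monomialL2)).topologicalClosure

instance completeSpace_bergmanSpace : CompleteSpace bergmanSpace :=
  inferInstanceAs (CompleteSpace (Submodule.span ℂ (Set.range monomialL2)).topologicalClosure)

/-- Pointwise multiplication by a function in `L^∞(𝔻)`, as a bounded operator on `L²(𝔻)`. -/
def mulOperator (φ : Lp ℂ ∞ diskMeasure) : L2Disk →L[ℂ] L2Disk :=
  (ContinuousLinearMap.mul ℂ ℂ).holderL diskMeasure ∞ 2 2 φ

lemma coeFn_mulOperator (φ : Lp ℂ ∞ diskMeasure) (f : L2Disk) :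
    mulOperator φ f =ᵐ[diskMeasure] fun z => φ z * f z :=
  (ContinuousLinearMap.mul ℂ ℂ).coeFn_holder φ f

/-- The Toeplitz operator `T(φ) f = P (φ f)` on the Bergman space, where `P` is the orthogonal
projection of `L²(𝔻)` onto the Bergman space. -/
def toeplitz (φ : Lp ℂ ∞ diskMeasure) : bergmanSpace →L[ℂ] bergmanSpace :=
  bergmanSpace.orthogonalProjectionOnto ∘L mulOperator φ ∘L bergmanSpace.subtypeL

/-- The singular values `s₀ ≥ s₁ ≥ …` of a (compact) operator `T` on a Hilbert space: the
eigenvalues of `|T| = (T* T)^{1/2}` in non-increasing order, with multiplicities. Namely, `sₙ` is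
the largest `t > 0` such that the eigenspaces of `|T|` for eigenvalues `≥ t` have total dimension
at least `n + 1`, and `sₙ = 0` if there is no such `t` (the supremum of the empty set is `0`). -/
def singularValue {H : Type*} [NormedAddCommGroup H] [InnerProductSpace ℂ H] [CompleteSpace H]
    (T : H →L[ℂ] H) (n : ℕ) : ℝ :=
  sSup {t : ℝ | 0 < t ∧ ((n + 1 : ℕ) : Cardinal) ≤
    Module.rank ℂ (⨆ μ ∈ Set.Ici t,
      Module.End.eigenspace ((CFC.abs T : H →L[ℂ] H) : H →ₗ[ℂ] H) (μ : ℂ) : Submodule ℂ H)}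

/-- The coefficient `2^{-γ} Γ(γ+1) (∫₀^{2π} |g(e^{iθ})|^{1/γ} dθ/2π)^γ`. -/
def toeplitzCoeff (γ : ℝ) (g : Circle → ℂ) : ℝ :=
  (2 : ℝ) ^ (-γ) * Real.Gamma (γ + 1) *
    ((2 * Real.pi)⁻¹ * ∫ θ in (0 : ℝ)..(2 * Real.pi), ‖g (Circle.exp θ)‖ ^ (1 / γ)) ^ γ

end

/-! In the orthonormal basis `√(k+1) z^k` the symbol `(1-|z|)^γ (z/|z|)^j` gives a weighted shift
`e_k ↦ c_k e_{k+j}`. Its weights are Beta integrals, and `c_k ~ κ k^{-γ}` with `κ = 2^{-γ} Γ(γ+1)`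
for every `j` (`tendsto_shiftWeight_mul_rpow`). Hence, for a trigonometric polynomial `p`, the
operator with symbol `(1-|z|)^γ p(z/|z|)` looks near index `k` like `κ k^{-γ}` times the Toeplitz
matrix of `p`.

Cut the indices into blocks of length `m`. On block `b` freeze the weight at `κ (bm)^{-γ}` and
replace the Toeplitz matrix by a circulant, which discrete Fourier vectors diagonalise with
eigenvalues `κ (bm)^{-γ} p(ω)`, `ω^m = 1`. Away from boundedly many indices per block, an initial
segment and a tail, the two operators nearly agree (`exists_normLEOffDim_sub_blockModel`). Counting
the eigenvalues of modulus above `σ n^{-γ}` is a Riemann sum, asymptotically `n (κ/σ)^{1/γ}` times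
the mean of `|p|^{1/γ}`. This equals `n` exactly when `σ` is the asserted coefficient of `p`.

For general `φ`, approximate `φ_∞` uniformly by `p`. The remaining symbol is at most a small
multiple of `(1-|z|)^γ` plus a faster decaying term. That radial majorant has a diagonal Toeplitz
operator, and Cauchy–Schwarz transfers its decay to the remainder (`normLEOffDim_toeplitz_of_le`).

The estimates are phrased with `NormLEOffDim` and `NormGEOnDim`, which behave well under
perturbation and bound singular values from above and below (`singularValue_le_of_normLEOffDim`,
`le_singularValue_of_normGEOnDim`). -/

/-! ### Min-max bounds and their stability under perturbation. -/

section OperatorBounds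

variable {H H' : Type*} [NormedAddCommGroup H] [InnerProductSpace ℂ H]
  [NormedAddCommGroup H'] [InnerProductSpace ℂ H']

/-- `‖T v‖ ≤ s ‖v‖` on the orthogonal complement of a subspace of dimension at most `r`. -/
def NormLEOffDim (T : H →L[ℂ] H') (r : ℕ) (s : ℝ) : Prop :=
  ∃ F : Submodule ℂ H, FiniteDimensional ℂ F ∧ Module.finrank ℂ F ≤ r ∧
    ∀ v ∈ Fᗮ, ‖T v‖ ≤ s * ‖v‖

/-- `s ‖v‖ ≤ ‖T v‖` on a subspace of dimension at least `r`. -/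
def NormGEOnDim (T : H →L[ℂ] H') (r : ℕ) (s : ℝ) : Prop :=
  ∃ V : Submodule ℂ H, FiniteDimensional ℂ V ∧ r ≤ Module.finrank ℂ V ∧
    ∀ v ∈ V, s * ‖v‖ ≤ ‖T v‖

lemma NormLEOffDim.mono {T : H →L[ℂ] H'} {r r' : ℕ} {s s' : ℝ} (h : NormLEOffDim T r s)
    (hr : r ≤ r') (hs : s ≤ s') : NormLEOffDim T r' s' := by
  obtain ⟨F, hF, hFr, hFs⟩ := h
  exact ⟨F, hF, hFr.trans hr, fun v hv => (hFs v hv).trans (by gcongr)⟩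

lemma NormGEOnDim.mono {T : H →L[ℂ] H'} {r r' : ℕ} {s s' : ℝ} (h : NormGEOnDim T r s)
    (hr : r' ≤ r) (hs : s' ≤ s) : NormGEOnDim T r' s' := by
  obtain ⟨F, hF, hFr, hFs⟩ := h
  exact ⟨F, hF, hr.trans hFr, fun v hv => le_trans (by gcongr) (hFs v hv)⟩

/-- The Ky Fan inequality `s_{r+r'}(S+T) ≤ s_r(S) + s_{r'}(T)`: exceptional subspaces add up. -/
lemma NormLEOffDim.add {S T : H →L[ℂ] H'} {r r' : ℕ} {s s' : ℝ} (hS : NormLEOffDim S r s)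
    (hT : NormLEOffDim T r' s') : NormLEOffDim (S + T) (r + r') (s + s') := by
  obtain ⟨F, hF, hFr, hFs⟩ := hS
  obtain ⟨G, hG, hGr, hGs⟩ := hT
  refine ⟨F ⊔ G, inferInstance, (Submodule.finrank_add_le_finrank_add_finrank F G).trans
    (add_le_add hFr hGr), fun v hv => ?_⟩
  have h1 := hFs v (Submodule.orthogonal_le le_sup_left hv)
  have h2 := hGs v (Submodule.orthogonal_le le_sup_right hv)
  calc ‖(S + T) v‖ ≤ ‖S v‖ + ‖T v‖ := norm_add_le _ _
    _ ≤ _ := by rw [add_mul]; exact add_le_add h1 h2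

/-- A subspace of dimension larger than `F` contains a nonzero vector orthogonal to `F`. -/
lemma exists_mem_orthogonal_ne_zero (F W : Submodule ℂ H) [FiniteDimensional ℂ F]
    (h : (Module.finrank ℂ F : Cardinal) < Module.rank ℂ W) : ∃ v ∈ W, v ∈ Fᗮ ∧ v ≠ 0 := by
  let P : W →ₗ[ℂ] F := F.orthogonalProjectionOnto.toLinearMap ∘ₗ W.subtype
  by_contra! hcon
  have hinj : Function.Injective P := by
    rw [← LinearMap.ker_eq_bot, LinearMap.ker_eq_bot']
    intro w hw
    have := hcon w w.2 (by
      rw [← Submodule.orthogonalProjectionOnto_eq_zero_iff]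
      simpa [P] using hw)
    exact_mod_cast this
  have := LinearMap.rank_le_of_injective P hinj
  rw [← Module.finrank_eq_rank ℂ F] at this
  exact absurd h (not_lt.mpr this)

/-- Rank–nullity for the orthogonal projection of `V` to `F`, whose kernel is `V ⊓ Fᗮ`. -/
lemma finrank_le_finrank_inf_orthogonal_add (V F : Submodule ℂ H) [FiniteDimensional ℂ F]
    [FiniteDimensional ℂ V] :
    Module.finrank ℂ V ≤ Module.finrank ℂ (V ⊓ Fᗮ : Submodule ℂ H) + Module.finrank ℂ F := by
  let P : V →ₗ[ℂ] F := F.orthogonalProjectionOnto.toLinearMap ∘ₗ V.subtype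
  have h1 := P.finrank_range_add_finrank_ker
  have h2 : Module.finrank ℂ (LinearMap.range P) ≤ Module.finrank ℂ F :=
    Submodule.finrank_le _
  have h3 : Module.finrank ℂ (LinearMap.ker P) ≤
      Module.finrank ℂ (V ⊓ Fᗮ : Submodule ℂ H) := by
    have : (LinearMap.ker P).map V.subtype ≤ V ⊓ Fᗮ := by
      rintro _ ⟨w, hw, rfl⟩
      refine ⟨w.2, ?_⟩
      rw [SetLike.mem_coe, ← Submodule.orthogonalProjectionOnto_eq_zero_iff]
      simpa [P] using hw
    rw [← Submodule.finrank_map_subtype_eq]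
    exact Submodule.finrank_mono this
  omega

/-- Lower counterpart of Ky Fan: removing the exceptional directions of `T - S` costs at most `r'`
dimensions of the subspace on which `S` is large. -/
lemma NormGEOnDim.of_sub {S T : H →L[ℂ] H'} {r r' : ℕ} {s s' : ℝ} (hS : NormGEOnDim S (r + r') s)
    (hT : NormLEOffDim (T - S) r' s') : NormGEOnDim T r (s - s') := by
  obtain ⟨V, hV, hVr, hVs⟩ := hS
  obtain ⟨F, hF, hFr, hFs⟩ := hT
  refine ⟨V ⊓ Fᗮ, inferInstance, ?_, fun v hv => ?_⟩
  · have := finrank_le_finrank_inf_orthogonal_add V F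
    omega
  · have h1 := hVs v hv.1
    have h2 := hFs v hv.2
    have h3 : ‖S v‖ ≤ ‖T v‖ + ‖(T - S) v‖ := by
      have := norm_sub_le (T v) ((T - S) v)
      simpa using this
    linarith [sub_mul s s' ‖v‖]

lemma NormLEOffDim.of_sub {S T : H →L[ℂ] H'} {r r' : ℕ} {s s' : ℝ} (hS : NormLEOffDim S r s)
    (hT : NormLEOffDim (T - S) r' s') : NormLEOffDim T (r + r') (s + s') := by
  simpa using hS.add hT

end OperatorBounds

/-! ### Compactness from the upper bounds. -/

section Compact

variable {H : Type*} [NormedAddCommGroup H] [InnerProductSpace ℂ H] [CompleteSpace H]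

/-- Composing `T` with the projection onto the exceptional subspace gives a finite-rank operator,
and what is left has norm at most `ε`. -/
lemma isCompactOperator_of_normLEOffDim {T : H →L[ℂ] H}
    (h : ∀ ε : ℝ, 0 < ε → ∃ r, NormLEOffDim T r ε) : IsCompactOperator T := by
  have : ∀ n : ℕ, ∃ S : H →L[ℂ] H, IsCompactOperator S ∧ ‖S - T‖ ≤ 1 / ((n : ℝ) + 1) := by
    intro n
    obtain ⟨r, F, hF, -, hFs⟩ := h (1 / ((n : ℝ) + 1)) (by positivity)
    refine ⟨(T ∘L F.subtypeL) ∘L F.orthogonalProjectionOnto, ?_, ?_⟩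
    · have : ProperSpace F := FiniteDimensional.proper ℂ F
      exact (isCompactOperator_of_locallyCompactSpace_rng (T ∘L F.subtypeL)).comp_clm _
    · refine ContinuousLinearMap.opNorm_le_bound _ (by positivity) fun v => ?_
      have h2 := hFs _ (F.sub_starProjection_mem_orthogonal v)
      have h3 : ‖v - F.starProjection v‖ ≤ ‖v‖ := by
        have := Fᗮ.norm_starProjection_apply_le v
        rwa [Submodule.starProjection_orthogonal_val] at this
      rw [← norm_neg]
      calc _ = ‖T (v - F.starProjection v)‖ := by
            rw [← map_neg]
            simp [sub_eq_add_neg, Submodule.starProjection_apply, add_comm,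
              -Submodule.coe_orthogonalProjectionOnto_apply]
        _ ≤ _ := h2.trans (by gcongr)
  choose S hS hST using this
  refine isCompactOperator_of_tendsto (l := atTop) (F := S) ?_ (Eventually.of_forall hS)
  rw [tendsto_iff_norm_sub_tendsto_zero]
  exact squeeze_zero (fun _ => norm_nonneg _) hST tendsto_one_div_add_atTop_nhds_zero_nat

end Compact

/-! ### Singular values through eigenspaces of `|T|`. -/

section Spectral

open Module End

variable {H : Type*} [NormedAddCommGroup H] [InnerProductSpace ℂ H]

/-- Eigenspaces of a symmetric operator are mutually orthogonal, so Pythagoras gives both norms; the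
two bounds that follow are termwise comparisons. -/
lemma exists_sum_of_mem_iSup_eigenspace {A : H →ₗ[ℂ] H} (hA : A.IsSymmetric) (S : Set ℂ) {u : H}
    (hu : u ∈ ⨆ μ : S, eigenspace A (μ : ℂ)) :
    ∃ (s : Finset S) (x : S → H), (∀ μ : S, x μ ∈ eigenspace A (μ : ℂ)) ∧
      ‖u‖ ^ 2 = ∑ μ ∈ s, ‖x μ‖ ^ 2 ∧ ‖A u‖ ^ 2 = ∑ μ ∈ s, ‖(μ : ℂ)‖ ^ 2 * ‖x μ‖ ^ 2 := by
  obtain ⟨f, hf, rfl⟩ := (Submodule.mem_iSup_iff_exists_finsupp _ _).mp hu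
  have hfam := hA.orthogonalFamily_eigenspaces.comp (Subtype.val_injective : Function.Injective
    (Subtype.val : S → ℂ))
  refine ⟨f.support, f, hf, ?_, ?_⟩
  · have := hfam.norm_sum (fun μ => ⟨f μ, hf μ⟩) f.support
    simpa [Finsupp.sum] using this
  · have := hfam.norm_sum (fun μ => (μ : ℂ) • ⟨f μ, hf μ⟩) f.support
    have h2 : A (f.sum fun _ x => x) = ∑ μ ∈ f.support, (μ : ℂ) • f μ := by
      rw [Finsupp.sum, map_sum]
      exact Finset.sum_congr rfl fun μ _ => mem_eigenspace_iff.mp (hf μ)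
    rw [h2]
    simpa [norm_smul, mul_pow] using this

lemma norm_apply_le_of_mem_iSup_eigenspace {A : H →ₗ[ℂ] H} (hA : A.IsSymmetric) (S : Set ℂ) {t : ℝ}
    (ht : 0 ≤ t) (hS : ∀ μ ∈ S, HasEigenvalue A μ → ‖μ‖ ≤ t) {u : H}
    (hu : u ∈ ⨆ μ : S, eigenspace A (μ : ℂ)) : ‖A u‖ ≤ t * ‖u‖ := by
  obtain ⟨s, x, hx, h1, h2⟩ := exists_sum_of_mem_iSup_eigenspace hA S hu
  refine le_of_sq_le_sq ?_ (by positivity)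
  rw [mul_pow, h1, h2, Finset.mul_sum]
  refine Finset.sum_le_sum fun μ _ => ?_
  by_cases h0 : x μ = 0
  · simp [h0]
  · have := hS μ μ.2 (hasEigenvalue_of_hasEigenvector ⟨hx μ, h0⟩)
    gcongr

lemma le_norm_apply_of_mem_iSup_eigenspace {A : H →ₗ[ℂ] H} (hA : A.IsSymmetric) (S : Set ℂ) {t : ℝ}
    (ht : 0 ≤ t) (hS : ∀ μ ∈ S, t ≤ ‖μ‖) {u : H}
    (hu : u ∈ ⨆ μ : S, eigenspace A (μ : ℂ)) : t * ‖u‖ ≤ ‖A u‖ := by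
  obtain ⟨s, x, hx, h1, h2⟩ := exists_sum_of_mem_iSup_eigenspace hA S hu
  refine le_of_sq_le_sq ?_ (by positivity)
  rw [mul_pow, h1, h2, Finset.mul_sum]
  refine Finset.sum_le_sum fun μ _ => ?_
  have := hS μ μ.2
  gcongr

/-- The set of complex numbers that are real and at least `t`. -/
def realsGE (t : ℝ) : Set ℂ := (fun x : ℝ => (x : ℂ)) '' Set.Ici t

lemma iSup_eigenspace_Ici_eq (A : H →ₗ[ℂ] H) (t : ℝ) :
    (⨆ μ ∈ Set.Ici t, eigenspace A (μ : ℂ)) = ⨆ μ : realsGE t, eigenspace A (μ : ℂ) := by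
  rw [iSup_subtype'' (realsGE t) (fun μ : ℂ => eigenspace A μ), realsGE, iSup_image]

variable [CompleteSpace H]

/-- By the spectral theorem for compact self-adjoint operators, `v` lies in the closed span of the
eigenspaces with eigenvalue below `t`; the bound holds on the span by Pythagoras and passes to the
closure. -/
lemma norm_apply_le_of_mem_orthogonal_iSup_eigenspace {A : H →L[ℂ] H} (hA : 0 ≤ A)
    (hc : IsCompactOperator A) {t : ℝ} (ht : 0 ≤ t) {v : H}
    (hv : v ∈ (⨆ μ : realsGE t, eigenspace (A : H →ₗ[ℂ] H) (μ : ℂ))ᗮ) : ‖A v‖ ≤ t * ‖v‖ := by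
  have hpos : A.IsPositive := (ContinuousLinearMap.nonneg_iff_isPositive A).mp hA
  have hsym : (A : H →ₗ[ℂ] H).IsSymmetric := hpos.isSymmetric
  set W := ⨆ μ : realsGE t, eigenspace (A : H →ₗ[ℂ] H) (μ : ℂ) with hW
  set U := ⨆ μ : ((realsGE t)ᶜ : Set ℂ), eigenspace (A : H →ₗ[ℂ] H) (μ : ℂ) with hU
  have hUW : U ≤ Wᗮ := by
    refine iSup_le fun μ => ?_
    intro x hx
    rw [Submodule.mem_orthogonal']
    intro w hw
    refine Submodule.iSup_induction _ (motive := fun w => inner ℂ x w = 0) hw ?_ (by simp) ?_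
    · intro ν y hy
      have hne : (μ : ℂ) ≠ ν := fun h => μ.2 (h ▸ ν.2)
      exact hsym.orthogonalFamily_eigenspaces hne ⟨x, hx⟩ ⟨y, hy⟩
    · intro a b ha hb
      rw [inner_add_right, ha, hb, add_zero]
  have hUc : U.topologicalClosure ≤ Wᗮ :=
    Submodule.topologicalClosure_minimal _ hUW (Submodule.isClosed_orthogonal _)
  have hvU : v ∈ U.topologicalClosure := by
    set K := U.topologicalClosure
    have : CompleteSpace K := (Submodule.isClosed_topologicalClosure U).completeSpace_coe
    set w := v - K.starProjection v
    have hw1 : w ∈ Kᗮ := K.sub_starProjection_mem_orthogonal v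
    have hw2 : w ∈ Wᗮ := Submodule.sub_mem _ hv (hUc (K.starProjection_apply_mem v))
    -- The component of `v` off `K` is orthogonal to all eigenspaces, those inside and those outside
    -- `realsGE t`, so it vanishes.
    have hw3 : w ∈ (⨆ μ, eigenspace (A : H →ₗ[ℂ] H) μ)ᗮ := by
      refine Submodule.orthogonal_le (K₂ := U ⊔ W) ?_ ?_
      · refine iSup_le fun μ => ?_
        by_cases h : μ ∈ realsGE t
        · exact (le_iSup (fun μ : realsGE t => eigenspace (A : H →ₗ[ℂ] H) (μ : ℂ))
            ⟨μ, h⟩).trans le_sup_right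
        · exact (le_iSup (fun μ : ((realsGE t)ᶜ : Set ℂ) => eigenspace (A : H →ₗ[ℂ] H) (μ : ℂ))
            ⟨μ, h⟩).trans le_sup_left
      · rw [← Submodule.inf_orthogonal]
        exact ⟨Submodule.orthogonal_le U.le_topologicalClosure hw1, hw2⟩
    rw [ContinuousLinearMap.orthogonalComplement_iSup_eigenspaces_eq_bot hc hsym,
      Submodule.mem_bot] at hw3
    have : v = K.starProjection v := sub_eq_zero.mp hw3
    rw [this]
    exact K.starProjection_apply_mem v
  have hcl : IsClosed {u : H | ‖A u‖ ≤ t * ‖u‖} :=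
    isClosed_le (by fun_prop) (by fun_prop)
  have hsub : (U : Set H) ⊆ {u : H | ‖A u‖ ≤ t * ‖u‖} := by
    intro u hu
    refine norm_apply_le_of_mem_iSup_eigenspace hsym _ ht ?_ hu
    intro μ hμ hev
    have h6 : ((μ.re : ℝ) : ℂ) = μ :=
      Complex.conj_eq_iff_re.mp (hsym.conj_eigenvalue_eq_self hev)
    have h1 : 0 ≤ μ.re := eigenvalue_nonneg_of_nonneg (𝕜 := ℂ) (by rwa [← h6] at hev)
      fun x => hpos.re_inner_nonneg_right x
    have h7 : μ.re < t := by
      by_contra! h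
      exact hμ ⟨μ.re, h, h6⟩
    rw [← h6, Complex.norm_real, Real.norm_eq_abs, abs_of_nonneg h1]
    exact h7.le
  exact closure_minimal hsub hcl hvU

lemma norm_abs_apply (T : H →L[ℂ] H) (v : H) : ‖(CFC.abs T : H →L[ℂ] H) v‖ = ‖T v‖ := by
  have h1 : (CFC.abs T : H →L[ℂ] H).IsPositive :=
    (ContinuousLinearMap.nonneg_iff_isPositive _).mp (CFC.abs_nonneg T)
  have h2 := CFC.abs_mul_abs T
  have h3 : inner ℂ ((CFC.abs T : H →L[ℂ] H) v) ((CFC.abs T : H →L[ℂ] H) v)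
      = inner ℂ (T v) (T v) := by
    rw [← ContinuousLinearMap.coe_coe, h1.isSymmetric, ContinuousLinearMap.coe_coe,
      ← mul_apply_eq_comp, h2, mul_apply_eq_comp,
      ContinuousLinearMap.star_eq_adjoint, ContinuousLinearMap.adjoint_inner_right]
  rw [inner_self_eq_norm_sq_to_K, inner_self_eq_norm_sq_to_K] at h3
  have h4 : ‖(CFC.abs T : H →L[ℂ] H) v‖ ^ 2 = ‖T v‖ ^ 2 := by exact_mod_cast h3
  exact (pow_left_inj₀ (norm_nonneg _) (norm_nonneg _) two_ne_zero).mp h4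

lemma singularValue_nonneg (T : H →L[ℂ] H) (n : ℕ) : 0 ≤ singularValue T n :=
  Real.sSup_nonneg fun _ ht => ht.1.le

lemma le_norm_apply_of_mem_iSup_eigenspace_abs (T : H →L[ℂ] H) {t : ℝ} (ht : 0 ≤ t) {v : H}
    (hv : v ∈ ⨆ μ ∈ Set.Ici t, eigenspace ((CFC.abs T : H →L[ℂ] H) : H →ₗ[ℂ] H) (μ : ℂ)) :
    t * ‖v‖ ≤ ‖T v‖ := by
  have h1 : (CFC.abs T : H →L[ℂ] H).IsPositive :=
    (ContinuousLinearMap.nonneg_iff_isPositive _).mp (CFC.abs_nonneg T)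
  rw [iSup_eigenspace_Ici_eq] at hv
  have := le_norm_apply_of_mem_iSup_eigenspace h1.isSymmetric (realsGE t) ht ?_ hv
  · rwa [ContinuousLinearMap.coe_coe, norm_abs_apply] at this
  · rintro _ ⟨x, hx, rfl⟩
    rw [Complex.norm_real]
    exact le_trans hx (le_abs_self x)

/-- If some `t > s` were admissible, the eigenspaces of `|T|` for eigenvalues `≥ t` would have
dimension above `n`, hence contain a nonzero vector orthogonal to the exceptional subspace. -/
lemma singularValue_le_of_normLEOffDim {T : H →L[ℂ] H} {n : ℕ} {s : ℝ} (hs : 0 ≤ s)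
    (h : NormLEOffDim T n s) : singularValue T n ≤ s := by
  refine Real.sSup_le ?_ hs
  rintro t ⟨ht, hrank⟩
  obtain ⟨F, hF, hFr, hFs⟩ := h
  obtain ⟨v, hv, hvF, hv0⟩ := exists_mem_orthogonal_ne_zero F _ (lt_of_lt_of_le
    (by exact_mod_cast Nat.lt_succ_of_le hFr) hrank)
  have h1 := le_norm_apply_of_mem_iSup_eigenspace_abs T ht.le hv
  have h2 := hFs v hvF
  exact le_of_mul_le_mul_right (h1.trans h2) (norm_pos_iff.mpr hv0)

/-- For `t` strictly between the two sides, the eigenspaces above `t` would have dimension at most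
`n`, so the given subspace would contain a nonzero vector orthogonal to them. There `|T|` is at most
`t`; this is where compactness, supplied by `hT`, enters. -/
lemma le_singularValue_of_normGEOnDim {T : H →L[ℂ] H} {n : ℕ} {s : ℝ}
    (hT : ∀ ε : ℝ, 0 < ε → ∃ r, NormLEOffDim T r ε) (h : NormGEOnDim T (n + 1) s) :
    s ≤ singularValue T n := by
  by_contra! hlt
  obtain ⟨t, ht1, ht2⟩ := exists_between hlt
  have ht0 : 0 < t := (singularValue_nonneg T n).trans_lt ht1
  refine absurd ht1 (not_lt.mpr ?_)
  -- Boundedness has to be checked, since the real supremum of an unbounded set is the default value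
  -- `0`.
  refine le_csSup ⟨‖T‖, ?_⟩ ⟨ht0, ?_⟩
  · rintro x ⟨hx, hrank⟩
    obtain ⟨v, hv, -, hv0⟩ := exists_mem_orthogonal_ne_zero (⊥ : Submodule ℂ H) _ (lt_of_lt_of_le
      (by simp) hrank)
    have h1 := le_norm_apply_of_mem_iSup_eigenspace_abs T hx.le hv
    exact le_of_mul_le_mul_right (h1.trans (T.le_opNorm v)) (norm_pos_iff.mpr hv0)
  · by_contra! hcon
    set W := ⨆ μ ∈ Set.Ici t, eigenspace ((CFC.abs T : H →L[ℂ] H) : H →ₗ[ℂ] H) (μ : ℂ) with hW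
    have hfd : FiniteDimensional ℂ W :=
      Module.rank_lt_aleph0_iff.mp (hcon.trans (Cardinal.natCast_lt_aleph0))
    obtain ⟨V, hV, hVr, hVs⟩ := h
    obtain ⟨v, hv, hvW, hv0⟩ := exists_mem_orthogonal_ne_zero W V (by
      rw [Module.finrank_eq_rank ℂ W, ← Module.finrank_eq_rank ℂ V]
      exact hcon.trans_le (by exact_mod_cast hVr))
    rw [hW, iSup_eigenspace_Ici_eq] at hvW
    have hcomp : IsCompactOperator (CFC.abs T : H →L[ℂ] H) :=
      isCompactOperator_of_normLEOffDim fun ε hε => by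
        obtain ⟨r, F, hF, hFr, hFs⟩ := hT ε hε
        exact ⟨r, F, hF, hFr, fun v hv => by rw [norm_abs_apply]; exact hFs v hv⟩
    have h1 := norm_apply_le_of_mem_orthogonal_iSup_eigenspace (CFC.abs_nonneg T) hcomp ht0.le hvW
    rw [norm_abs_apply] at h1
    have h2 := le_of_mul_le_mul_right ((hVs v hv).trans h1) (norm_pos_iff.mpr hv0)
    linarith

end Spectral

/-! ### Operators with orthogonal images, and diagonal operators. -/

section Diagonal

variable {H H' : Type*} [NormedAddCommGroup H] [InnerProductSpace ℂ H]
  [NormedAddCommGroup H'] [InnerProductSpace ℂ H']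

lemma norm_sq_sum_of_pairwise_inner_eq_zero {ι : Type*} (s : Finset ι) (y : ι → H)
    (h : ∀ i ∈ s, ∀ j ∈ s, i ≠ j → inner ℂ (y i) (y j) = 0) :
    ‖∑ i ∈ s, y i‖ ^ 2 = ∑ i ∈ s, ‖y i‖ ^ 2 := by
  classical
  induction s using Finset.induction_on with
  | empty => simp
  | insert a s ha ih =>
    rw [Finset.sum_insert ha, Finset.sum_insert ha, ← ih fun i hi j hj =>
      h i (Finset.mem_insert_of_mem hi) j (Finset.mem_insert_of_mem hj), sq, sq, sq]
    refine norm_add_sq_eq_norm_sq_add_norm_sq_of_inner_eq_zero (𝕜 := ℂ) _ _ ?_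
    rw [inner_sum]
    refine Finset.sum_eq_zero fun i hi => h a (Finset.mem_insert_self _ _) i
      (Finset.mem_insert_of_mem hi) ?_
    rintro rfl
    exact ha hi

/-- An operator mapping the basis vectors with index outside `E` to pairwise orthogonal vectors of
norm at most `ε` has norm at most `ε` on the closed span of these basis vectors. -/
lemma norm_apply_le_of_pairwise_inner_eq_zero {ι : Type*} (e : HilbertBasis ι ℂ H)
    (X : H →L[ℂ] H') (E : Set ι) {ε : ℝ} (hε : 0 ≤ ε)
    (horth : ∀ i ∉ E, ∀ j ∉ E, i ≠ j → inner ℂ (X (e i)) (X (e j)) = 0)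
    (hnorm : ∀ i ∉ E, ‖X (e i)‖ ≤ ε) {v : H} (hv : ∀ i ∈ E, inner ℂ (e i) v = 0) :
    ‖X v‖ ≤ ε * ‖v‖ := by
  have hsum := e.hasSum_repr v
  have h0 : ∀ i ∈ E, e.repr v i = 0 := fun i hi => by rw [e.repr_apply_apply, hv i hi]
  -- Pythagoras in both spaces settles finite partial sums; continuity then gives the full
  -- expansion.
  have hfin : ∀ s : Finset ι, ‖X (∑ i ∈ s, e.repr v i • e i)‖ ≤
      ε * ‖∑ i ∈ s, e.repr v i • e i‖ := by
    intro s
    refine le_of_sq_le_sq ?_ (by positivity)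
    rw [map_sum, mul_pow, norm_sq_sum_of_pairwise_inner_eq_zero,
      norm_sq_sum_of_pairwise_inner_eq_zero, Finset.mul_sum]
    · refine Finset.sum_le_sum fun i _ => ?_
      by_cases hi : i ∈ E
      · simp [h0 i hi]
      · rw [← mul_pow, map_smul, norm_smul, norm_smul, e.orthonormal.1 i, mul_one, mul_comm]
        have := hnorm i hi
        gcongr
    · intro i _ j _ hij
      rw [inner_smul_left, inner_smul_right, e.orthonormal.2 hij, mul_zero, mul_zero]
    · intro i _ j _ hij
      rw [map_smul, map_smul, inner_smul_left, inner_smul_right]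
      by_cases hi : i ∈ E
      · simp [h0 i hi]
      by_cases hj : j ∈ E
      · simp [h0 j hj]
      rw [horth i hi j hj hij, mul_zero, mul_zero]
  have h1 : Tendsto (fun s : Finset ι => ‖X (∑ i ∈ s, e.repr v i • e i)‖) atTop (𝓝 ‖X v‖) :=
    (X.continuous.norm.tendsto v).comp hsum
  have h2 : Tendsto (fun s : Finset ι => ε * ‖∑ i ∈ s, e.repr v i • e i‖) atTop (𝓝 (ε * ‖v‖)) :=
    (continuous_norm.tendsto v).comp hsum |>.const_mul ε
  exact le_of_tendsto_of_tendsto' h1 h2 hfin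

/-- The operator that is diagonal in the family `f`, with entries `c`. -/
noncomputable def diagOp {ι : Type*} [Fintype ι] (f : ι → H) (c : ι → ℂ) : H →L[ℂ] H :=
  ∑ x, c x • (innerSL ℂ (f x)).smulRight (f x)

lemma diagOp_apply {ι : Type*} [Fintype ι] (f : ι → H) (c : ι → ℂ) (v : H) :
    diagOp f c v = ∑ x, (c x * inner ℂ (f x) v) • f x := by
  simp [diagOp, smul_smul]

lemma norm_sq_diagOp_apply {ι : Type*} [Fintype ι] {f : ι → H} (hf : Orthonormal ℂ f) (c : ι → ℂ)
    (v : H) : ‖diagOp f c v‖ ^ 2 = ∑ x, ‖c x‖ ^ 2 * ‖inner ℂ (f x) v‖ ^ 2 := by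
  rw [diagOp_apply, norm_sq_sum_of_pairwise_inner_eq_zero]
  · simp [norm_smul, hf.1, mul_pow]
  · intro i _ j _ hij
    rw [inner_smul_left, inner_smul_right, hf.2 hij, mul_zero, mul_zero]

open Classical in
lemma normLEOffDim_diagOp {ι : Type*} [Fintype ι] {f : ι → H} (hf : Orthonormal ℂ f) (c : ι → ℂ)
    {s : ℝ} (hs : 0 ≤ s) :
    NormLEOffDim (diagOp f c) (Finset.univ.filter fun x => s < ‖c x‖).card s := by
  set G := Finset.univ.filter fun x => s < ‖c x‖
  refine ⟨Submodule.span ℂ (G.image f : Set H), FiniteDimensional.span_finset ℂ _,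
    (finrank_span_finset_le_card _).trans Finset.card_image_le, fun v hv => ?_⟩
  refine le_of_sq_le_sq ?_ (by positivity)
  rw [norm_sq_diagOp_apply hf, mul_pow]
  refine le_trans ?_ (mul_le_mul_of_nonneg_left (hf.sum_inner_products_le v (s := Finset.univ))
    (sq_nonneg s))
  rw [Finset.mul_sum]
  refine Finset.sum_le_sum fun x _ => ?_
  by_cases hx : x ∈ G
  · have : inner ℂ (f x) v = 0 := hv _ (Submodule.subset_span (by
      rw [Finset.coe_image]; exact ⟨x, hx, rfl⟩))
    simp [this]
  · have : ‖c x‖ ≤ s := by simpa [G] using hx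
    gcongr

open Classical in
lemma normGEOnDim_diagOp {ι : Type*} [Fintype ι] {f : ι → H} (hf : Orthonormal ℂ f) (c : ι → ℂ)
    {s : ℝ} (hs : 0 ≤ s) :
    NormGEOnDim (diagOp f c) (Finset.univ.filter fun x => s ≤ ‖c x‖).card s := by
  set G := Finset.univ.filter fun x => s ≤ ‖c x‖
  have hg : LinearIndependent ℂ (fun x : G => f x) :=
    hf.linearIndependent.comp _ Subtype.val_injective
  refine ⟨Submodule.span ℂ (Set.range fun x : G => f x),
    FiniteDimensional.span_of_finite ℂ (Set.finite_range _), ?_, fun v hv => ?_⟩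
  · rw [finrank_span_eq_card hg, Fintype.card_coe]
  obtain ⟨a, rfl⟩ := (Submodule.mem_span_range_iff_exists_fun ℂ).mp hv
  refine le_of_sq_le_sq ?_ (by positivity)
  rw [norm_sq_diagOp_apply hf, mul_pow, norm_sq_sum_of_pairwise_inner_eq_zero]
  · have hin : ∀ x : G, inner ℂ (f x) (∑ y : G, a y • f y) = a x := by
      intro x
      rw [inner_sum, Finset.sum_eq_single x]
      · rw [inner_smul_right, inner_self_eq_norm_sq_to_K, hf.1]; simp
      · intro y _ hy
        rw [inner_smul_right, hf.2 (fun h => hy (Subtype.ext h.symm)), mul_zero]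
      · simp
    calc s ^ 2 * ∑ x : G, ‖a x • f x‖ ^ 2
        = ∑ x : G, s ^ 2 * ‖inner ℂ (f x) (∑ y : G, a y • f y)‖ ^ 2 := by
          rw [Finset.mul_sum]
          exact Finset.sum_congr rfl fun x _ => by rw [hin, norm_smul, hf.1, mul_one]
      _ ≤ ∑ x : G, ‖c x‖ ^ 2 * ‖inner ℂ (f x) (∑ y : G, a y • f y)‖ ^ 2 := by
          refine Finset.sum_le_sum fun x _ => ?_
          have : s ≤ ‖c x‖ := (Finset.mem_filter.mp x.2).2
          gcongr
      _ = ∑ x ∈ G, ‖c x‖ ^ 2 * ‖inner ℂ (f x) (∑ y : G, a y • f y)‖ ^ 2 :=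
          Finset.sum_coe_sort G fun x => ‖c x‖ ^ 2 * ‖inner ℂ (f x) (∑ y : G, a y • f y)‖ ^ 2
      _ ≤ _ := Finset.sum_le_univ_sum_of_nonneg fun x => by positivity
  · intro i _ j _ hij
    rw [inner_smul_left, inner_smul_right, hf.2 (fun h => hij (Subtype.ext h)), mul_zero, mul_zero]

end Diagonal

/-! ### Discrete Fourier vectors on blocks of basis indices. -/

section BlockFourier

/-- The `l`-th of the `m`-th roots of unity. -/
noncomputable def rootOfUnityPoint (m l : ℕ) : Circle := Circle.exp (2 * Real.pi * (l / m))

lemma sum_rootOfUnityPoint_zpow {m : ℕ} (hm : 0 < m) {q : ℤ} (hq : |q| < m) :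
    ∑ l : Fin m, (rootOfUnityPoint m l : ℂ) ^ q = if q = 0 then (m : ℂ) else 0 := by
  have hprim := Complex.isPrimitiveRoot_exp m hm.ne'
  set ζ := Complex.exp (2 * Real.pi * Complex.I / m)
  have hζ : ∀ l : ℕ, (rootOfUnityPoint m l : ℂ) ^ q = (ζ ^ q) ^ l := by
    intro l
    have : (rootOfUnityPoint m l : ℂ) = ζ ^ l := by
      rw [rootOfUnityPoint, Circle.coe_exp, ← Complex.exp_nat_mul]
      congr 1
      push_cast
      ring
    rw [this, ← zpow_natCast, ← zpow_natCast, zpow_comm]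
  rw [Fin.sum_univ_eq_sum_range (fun l => (rootOfUnityPoint m l : ℂ) ^ q) m,
    Finset.sum_congr rfl fun l _ => hζ l]
  split_ifs with h
  · simp [h]
  · have h1 : ζ ^ q ≠ 1 := by
      rw [Ne, hprim.zpow_eq_one_iff_dvd]
      intro hd
      exact h (Int.eq_zero_of_abs_lt_dvd hd hq)
    have h2 : (ζ ^ q) ^ m = 1 := by
      rw [← zpow_natCast, zpow_comm, zpow_natCast, hprim.pow_eq_one, one_zpow]
    rw [geom_sum_eq h1, h2, sub_self, zero_div]

variable {H : Type*} [NormedAddCommGroup H] [InnerProductSpace ℂ H]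

/-- The `l`-th discrete Fourier vector of the block `e (bm), …, e (bm + m - 1)`. -/
noncomputable def blockFourier (e : ℕ → H) (m b l : ℕ) : H :=
  -- With the exponent `-i`, the cyclic shift by `j` multiplies the vector by the `j`-th power, not
  -- the `-j`-th.
  ∑ i : Fin m, (((Real.sqrt m)⁻¹ : ℝ) * (rootOfUnityPoint m l : ℂ) ^ (-(i : ℤ))) • e (b * m + i)

lemma block_index_eq {m b b' i i' : ℕ} (hi : i < m) (hi' : i' < m) :
    b * m + i = b' * m + i' ↔ b = b' ∧ i = i' := by
  have hm : 0 < m := by omega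
  constructor
  · intro h
    have h1 : (b * m + i) / m = (b' * m + i') / m := by rw [h]
    rw [mul_comm b, mul_comm b', Nat.mul_add_div hm, Nat.mul_add_div hm, Nat.div_eq_of_lt hi,
      Nat.div_eq_of_lt hi'] at h1
    have : b = b' := by simpa using h1
    subst this
    exact ⟨rfl, by omega⟩
  · rintro ⟨rfl, rfl⟩; rfl

lemma inner_blockFourier_left {e : ℕ → H} (he : Orthonormal ℂ e) {m : ℕ} (b l b' : ℕ) {i : ℕ}
    (hi : i < m) : inner ℂ (blockFourier e m b l) (e (b' * m + i)) =
      if b = b' then ((Real.sqrt m)⁻¹ : ℝ) * (rootOfUnityPoint m l : ℂ) ^ (i : ℤ) else 0 := by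
  rw [blockFourier, sum_inner]
  have h : ∀ k : Fin m, inner ℂ ((((Real.sqrt m)⁻¹ : ℝ) *
      (rootOfUnityPoint m l : ℂ) ^ (-(k : ℤ))) • e (b * m + k)) (e (b' * m + i)) =
      if k = ⟨i, hi⟩ then (if b = b' then ((Real.sqrt m)⁻¹ : ℝ) *
        (rootOfUnityPoint m l : ℂ) ^ (i : ℤ) else 0) else 0 := by
    intro k
    rw [inner_smul_left, orthonormal_iff_ite.mp he, map_mul, Complex.conj_ofReal, map_zpow₀,
      ← Circle.coe_inv_eq_conj, Circle.coe_inv, inv_zpow', neg_neg]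
    by_cases hk : k = ⟨i, hi⟩
    · subst hk
      by_cases hb : b = b' <;> simp [hb]
    · have : (k : ℕ) ≠ i := fun h => hk (Fin.ext h)
      simp [block_index_eq k.2 hi, this, hk]
  rw [Finset.sum_congr rfl fun k _ => h k]
  simp

lemma orthonormal_blockFourier {e : ℕ → H} (he : Orthonormal ℂ e) {m : ℕ} (hm : 0 < m) (B M : ℕ) :
    Orthonormal ℂ (fun x : Fin M × Fin m => blockFourier e m (B + x.1) x.2) := by
  rw [orthonormal_iff_ite]
  rintro ⟨b, l⟩ ⟨b', l'⟩
  dsimp only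
  conv_lhs => rw [blockFourier.eq_def e m (B + b') l', inner_sum]
  simp only [inner_smul_right, inner_blockFourier_left he (B + b) l (B + b') (Fin.is_lt _)]
  by_cases hb : b = b'
  · subst hb
    have hq : |(l : ℤ) - (l' : ℤ)| < m := by
      rw [abs_lt]; constructor <;> have := l.2 <;> have := l'.2 <;> omega
    have hsq : (((Real.sqrt m)⁻¹ : ℝ) : ℂ) * (((Real.sqrt m)⁻¹ : ℝ) : ℂ) = (m : ℂ)⁻¹ := by
      rw [← Complex.ofReal_mul, ← mul_inv, Real.mul_self_sqrt (by positivity)]; simp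
    -- The value `exp(2πi·il/m)` is symmetric in `i` and `l`; exchanging them turns the inner
    -- product into a sum of one power over all roots of unity.
    have hterm : ∀ i : Fin m, (((Real.sqrt m)⁻¹ : ℝ) : ℂ) *
        (rootOfUnityPoint m l' : ℂ) ^ (-(i : ℤ)) * ((((Real.sqrt m)⁻¹ : ℝ) : ℂ) *
        (rootOfUnityPoint m l : ℂ) ^ (i : ℤ)) =
        (m : ℂ)⁻¹ * (rootOfUnityPoint m i : ℂ) ^ ((l : ℤ) - l') := by
      intro i
      rw [mul_mul_mul_comm, hsq]
      congr 1
      simp only [rootOfUnityPoint, Circle.coe_exp, ← Complex.exp_int_mul, ← Complex.exp_add]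
      congr 1
      push_cast
      ring
    simp only [if_true]
    rw [Finset.sum_congr rfl fun i _ => hterm i, ← Finset.mul_sum,
      sum_rootOfUnityPoint_zpow hm hq]
    have hm' : (m : ℂ) ≠ 0 := by exact_mod_cast hm.ne'
    by_cases hl : l = l'
    · subst hl; simp [hm']
    · have : (l : ℤ) - l' ≠ 0 := fun h => hl (Fin.ext (by omega))
      simp [this, hl]
  · have hb' : B + (b : ℕ) ≠ B + b' := fun h => hb (Fin.ext (by omega))
    simp only [hb', if_false, mul_zero, Finset.sum_const_zero, Prod.mk.injEq, hb, false_and]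

/-- Within a block, and away from its edges, the circulant operator acts as a shift. -/
lemma diagOp_blockFourier_apply {e : ℕ → H} (he : Orthonormal ℂ e) {m : ℕ} (hm : 0 < m) (B M : ℕ)
    (w : Fin M → ℂ) (j : ℤ) (b i i' : ℕ) (hi : i < m) (hi' : i' < m) (hij : (i : ℤ) + j = i') :
    diagOp (fun x : Fin M × Fin m => blockFourier e m (B + x.1) x.2)
      (fun x => w x.1 * (rootOfUnityPoint m x.2 : ℂ) ^ j) (e (b * m + i)) =
      ∑ y : Fin M, if B + (y : ℕ) = b then w y • e (b * m + i') else 0 := by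
  rw [diagOp_apply, Fintype.sum_prod_type]
  refine Finset.sum_congr rfl fun y _ => ?_
  dsimp only
  simp only [inner_blockFourier_left he (B + y) _ b hi]
  split_ifs with hb
  · have hsq : (((Real.sqrt m)⁻¹ : ℝ) : ℂ) * (((Real.sqrt m)⁻¹ : ℝ) : ℂ) = (m : ℂ)⁻¹ := by
      rw [← Complex.ofReal_mul, ← mul_inv, Real.mul_self_sqrt (by positivity)]; simp
    have hm' : (m : ℂ) ≠ 0 := by exact_mod_cast hm.ne'
    simp only [blockFourier, Finset.smul_sum, smul_smul]
    -- Summing over the Fourier index kills every `k ≠ i'`, as `|i' - k| < m`. Since `i + j = i'`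
    -- stays inside the block, there is no wrap-around.
    rw [Finset.sum_comm, Finset.sum_eq_single ⟨i', hi'⟩]
    · rw [← Finset.sum_smul, hb]
      congr 1
      have : ∀ l : Fin m, w y * (rootOfUnityPoint m l : ℂ) ^ j * ((((Real.sqrt m)⁻¹ : ℝ) : ℂ) *
          (rootOfUnityPoint m l : ℂ) ^ (i : ℤ)) * ((((Real.sqrt m)⁻¹ : ℝ) : ℂ) *
          (rootOfUnityPoint m l : ℂ) ^ (-(i' : ℤ))) = w y * (m : ℂ)⁻¹ := by
        intro l
        have hne : (rootOfUnityPoint m l : ℂ) ≠ 0 := Circle.coe_ne_zero _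
        rw [← hij, neg_add, zpow_add₀ hne, ← hsq, zpow_neg, zpow_neg]
        field_simp
      rw [Finset.sum_congr rfl fun l _ => this l]
      simp
      field_simp
    · intro k _ hk
      rw [← Finset.sum_smul]
      have : ∀ l : Fin m, w y * (rootOfUnityPoint m l : ℂ) ^ j * ((((Real.sqrt m)⁻¹ : ℝ) : ℂ) *
          (rootOfUnityPoint m l : ℂ) ^ (i : ℤ)) * ((((Real.sqrt m)⁻¹ : ℝ) : ℂ) *
          (rootOfUnityPoint m l : ℂ) ^ (-(k : ℤ))) = w y * (m : ℂ)⁻¹ *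
          (rootOfUnityPoint m l : ℂ) ^ ((i' : ℤ) - k) := by
        intro l
        have hne : (rootOfUnityPoint m l : ℂ) ≠ 0 := Circle.coe_ne_zero _
        rw [← hij, sub_eq_add_neg, zpow_add₀ hne, zpow_add₀ hne, ← hsq]
        ring
      have hne : (i' : ℤ) - k ≠ 0 := fun h => hk (Fin.ext (by simp; omega))
      rw [Finset.sum_congr rfl fun l _ => this l, ← Finset.mul_sum, sum_rootOfUnityPoint_zpow hm,
        if_neg hne, mul_zero, zero_smul]
      rw [abs_lt]; constructor <;> have := k.2 <;> omega
    · simp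
  · simp

end BlockFourier

/-! ### The block-circulant model and its distance to sums of weighted shifts. -/

section BlockModel

variable {H : Type*} [NormedAddCommGroup H] [InnerProductSpace ℂ H]

/-- Weighted circulants on the blocks `B, …, B + M - 1` of length `m`, with weight `κ (bm)^{-γ}` and
symbol `p` on the block `b`. -/
noncomputable def blockModel (e : ℕ → H) (κ γ : ℝ) (p : Circle → ℂ) (m B M : ℕ) : H →L[ℂ] H :=
  diagOp (fun x : Fin M × Fin m => blockFourier e m (B + x.1) x.2)
    (fun x => ((κ * (((B + x.1 : ℕ) : ℝ) * m) ^ (-γ) : ℝ) : ℂ) * p (rootOfUnityPoint m x.2))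

/-- The Laurent polynomial `∑ a_j ζ^j` on the circle. -/
noncomputable def trigPoly (J : Finset ℤ) (a : ℤ → ℂ) (ζ : Circle) : ℂ :=
  ∑ j ∈ J, a j * (ζ : ℂ) ^ j

lemma blockModel_trigPoly (e : ℕ → H) (κ γ : ℝ) (J : Finset ℤ) (a : ℤ → ℂ) (m B M : ℕ) :
    blockModel e κ γ (trigPoly J a) m B M =
      ∑ j ∈ J, a j • blockModel e κ γ (fun ζ => (ζ : ℂ) ^ j) m B M := by
  ext v
  simp only [blockModel, trigPoly, FunLike.coe_sum, Finset.sum_apply,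
    smul_apply, diagOp_apply]
  simp_rw [Finset.smul_sum, smul_smul]
  rw [Finset.sum_comm]
  refine Finset.sum_congr rfl fun x _ => ?_
  rw [← Finset.sum_smul, Finset.mul_sum, Finset.sum_mul]
  congr 1
  exact Finset.sum_congr rfl fun j _ => by ring

/-- The indices before the block `B`, or within `d` of an edge of a block up to `B + M`. -/
def blockEdges (m B M d : ℕ) : Finset ℕ :=
  Finset.range (B * m) ∪
    -- The extra `+ 1` covers the right end of the last block. Truncated subtraction can only
    -- produce the index `0`, which does not affect the cardinality bound.
    (Finset.range (B + M + 1) ×ˢ Finset.range (2 * d)).image fun x => x.1 * m + x.2 - d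

lemma card_blockEdges_le (m B M d : ℕ) :
    (blockEdges m B M d).card ≤ B * m + (B + M + 1) * (2 * d) := by
  refine (Finset.card_union_le _ _).trans (add_le_add (by simp) ?_)
  exact Finset.card_image_le.trans (by simp)

lemma norm_sub_blockModel_zpow_le (e : HilbertBasis ℕ ℂ H) {κ γ ε : ℝ} (hε : 0 ≤ ε) {j : ℤ}
    {A : H →L[ℂ] H} {c : ℕ → ℝ}
    (hA : ∀ k i : ℕ, (k : ℤ) + j = i → A (e k) = (c k : ℂ) • e i)
    {m B M d : ℕ} (hB : 0 < B) (hm : 0 < m) (hd : d ≤ m) (hj : |j| ≤ d)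
    (h1 : ∀ b, B ≤ b → b < B + M → ∀ k, b * m ≤ k → k < (b + 1) * m →
      |c k - κ * ((b : ℝ) * m) ^ (-γ)| ≤ ε)
    (h2 : ∀ k, (B + M) * m ≤ k → |c k| ≤ ε) {v : H}
    (hv : ∀ k ∈ blockEdges m B M d, inner ℂ (e k) v = 0) :
    ‖(A - blockModel e κ γ (fun ζ => (ζ : ℂ) ^ j) m B M) v‖ ≤ ε * ‖v‖ := by
  -- Off the edges both operators send `e k` to a multiple of `e (k + j)`, so the difference is a
  -- weighted shift there and its norm is governed by its entries.
  have key : ∀ k ∉ blockEdges m B M d, ∃ (i : ℕ) (t : ℝ), (k : ℤ) + j = i ∧ |t| ≤ ε ∧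
      (A - blockModel e κ γ (fun ζ => (ζ : ℂ) ^ j) m B M) (e k) = (t : ℂ) • e i := by
    intro k hk
    simp only [blockEdges, Finset.mem_union, Finset.mem_range, not_or, not_lt, Finset.mem_image,
      Finset.mem_product, not_exists, Prod.forall, not_and, and_imp] at hk
    obtain ⟨hk1, hk2⟩ := hk
    obtain ⟨hj1, hj2⟩ := abs_le.mp hj
    have hmB : m ≤ B * m := Nat.le_mul_of_pos_left m hB
    obtain ⟨i, hi⟩ : ∃ i : ℕ, (k : ℤ) + j = i := ⟨((k : ℤ) + j).toNat, by omega⟩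
    set b := k / m with hb
    have hkb : b * m + k % m = k := by rw [hb, mul_comm]; exact Nat.div_add_mod k m
    have hkm : k % m < m := Nat.mod_lt _ hm
    have hBb : B ≤ b := (Nat.le_div_iff_mul_le hm).mpr hk1
    by_cases hbM : b < B + M
    · have hlo : d ≤ k % m := by
        by_contra! h
        exact hk2 b (k % m + d) (by omega) (by omega) (by omega)
      have hhi : k % m + d < m := by
        by_contra! h
        -- An index close to the right end of block `b` is listed as close to the left end of block
        -- `b + 1`.
        refine hk2 (b + 1) (k % m + d - m) (by omega) (by omega) ?_
        have : (b + 1) * m = b * m + m := by ring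
        omega
      obtain ⟨i', hi'⟩ : ∃ i' : ℕ, ((k % m : ℕ) : ℤ) + j = i' :=
        ⟨(((k % m : ℕ) : ℤ) + j).toNat, by omega⟩
      have hi'm : i' < m := by omega
      have hii' : b * m + i' = i := by omega
      refine ⟨i, c k - κ * ((b : ℝ) * m) ^ (-γ), hi,
        h1 b hBb hbM k (by omega) (by have : (b + 1) * m = b * m + m := by ring
                                      omega), ?_⟩
      rw [sub_apply, hA k i hi]
      have h3 := diagOp_blockFourier_apply e.orthonormal hm B M
        (fun y : Fin M => ((κ * (((B + y : ℕ) : ℝ) * m) ^ (-γ) : ℝ) : ℂ)) j b (k % m) i' hkm hi'm hi'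
      rw [hkb, hii'] at h3
      rw [blockModel, h3, Finset.sum_eq_single ⟨b - B, by omega⟩]
      · have : B + (b - B) = b := by omega
        simp only [this, if_true]
        rw [← sub_smul]
        push_cast
        rfl
      · intro y _ hy
        rw [if_neg]
        intro h
        exact hy (Fin.ext (by simp; omega))
      · simp
    · refine ⟨i, c k, hi, h2 k ?_, ?_⟩
      · calc (B + M) * m ≤ b * m := Nat.mul_le_mul_right _ (by omega)
          _ ≤ k := by omega
      · rw [sub_apply, hA k i hi, blockModel, diagOp_apply,
          Finset.sum_eq_zero, sub_zero]
        intro x _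
        have := inner_blockFourier_left e.orthonormal (B + x.1) x.2 b hkm
        rw [hkb, if_neg (by omega)] at this
        rw [this, mul_zero, zero_smul]
  refine norm_apply_le_of_pairwise_inner_eq_zero e _ (blockEdges m B M d : Set ℕ) hε ?_ ?_ hv
  · intro k hk k' hk' hkk'
    obtain ⟨i, t, hi, -, ht⟩ := key k hk
    obtain ⟨i', t', hi', -, ht'⟩ := key k' hk'
    rw [ht, ht', inner_smul_left, inner_smul_right, e.orthonormal.2 (by omega), mul_zero, mul_zero]
  · intro k hk
    obtain ⟨i, t, -, ht, hk⟩ := key k hk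
    rw [hk, norm_smul, e.orthonormal.1, mul_one, Complex.norm_real]
    exact ht

lemma normLEOffDim_sub_blockModel (e : HilbertBasis ℕ ℂ H) {κ γ ε : ℝ} (hε : 0 ≤ ε)
    {J : Finset ℤ} {a : ℤ → ℂ} {A : ℤ → H →L[ℂ] H} {c : ℤ → ℕ → ℝ}
    (hA : ∀ j, ∀ k i : ℕ, (k : ℤ) + j = i → A j (e k) = (c j k : ℂ) • e i)
    {m B M d : ℕ} (hB : 0 < B) (hm : 0 < m) (hd : d ≤ m) (hj : ∀ j ∈ J, |j| ≤ d)
    (h1 : ∀ j ∈ J, ∀ b, B ≤ b → b < B + M → ∀ k, b * m ≤ k → k < (b + 1) * m →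
      |c j k - κ * ((b : ℝ) * m) ^ (-γ)| ≤ ε)
    (h2 : ∀ j ∈ J, ∀ k, (B + M) * m ≤ k → |c j k| ≤ ε) :
    NormLEOffDim ((∑ j ∈ J, a j • A j) - blockModel e κ γ (trigPoly J a) m B M)
      (B * m + (B + M + 1) * (2 * d)) ((∑ j ∈ J, ‖a j‖) * ε) := by
  classical
  refine ⟨Submodule.span ℂ ((blockEdges m B M d).image e : Set H),
    FiniteDimensional.span_finset ℂ _, (finrank_span_finset_le_card _).trans
      (Finset.card_image_le.trans (card_blockEdges_le m B M d)), fun v hv => ?_⟩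
  have hv' : ∀ k ∈ blockEdges m B M d, inner ℂ (e k) v = 0 := fun k hk =>
    hv _ (Submodule.subset_span (by rw [Finset.coe_image]; exact ⟨k, hk, rfl⟩))
  rw [blockModel_trigPoly, ← Finset.sum_sub_distrib, Finset.sum_mul, Finset.sum_mul]
  simp only [← smul_sub, FunLike.coe_sum, Finset.sum_apply]
  refine (norm_sum_le _ _).trans (Finset.sum_le_sum fun j hjJ => ?_)
  rw [smul_apply, norm_smul, mul_assoc]
  exact mul_le_mul_of_nonneg_left (norm_sub_blockModel_zpow_le e hε (hA j) hB hm hd (hj j hjJ)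
    (h1 j hjJ) (h2 j hjJ) hv') (norm_nonneg _)

end BlockModel

/-! ### Freezing the weights and choosing the scales. -/

/-- A sequence asymptotic to `κ k^{-γ}` is nearly constant on the blocks `[bm, (b + 1)m)`. -/
lemma eventually_abs_sub_block_le {c : ℕ → ℝ} {κ γ : ℝ} (hγ : 0 < γ) (hκ : 0 < κ)
    (hc : Tendsto (fun k : ℕ => c k * (k : ℝ) ^ γ) atTop (𝓝 κ)) {ε : ℝ} (hε : 0 < ε) :
    ∀ᶠ K : ℕ in atTop, ∀ m, K ≤ m → ∀ b, K ≤ b → ∀ k, b * m ≤ k → k < (b + 1) * m →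
      |c k - κ * ((b : ℝ) * m) ^ (-γ)| ≤ ε * ((b : ℝ) * m) ^ (-γ) := by
  have h1 : ∀ᶠ k : ℕ in atTop, |c k * (k : ℝ) ^ γ - κ| ≤ ε / 2 := by
    have := (tendsto_iff_dist_tendsto_zero.mp hc).eventually (ge_mem_nhds (half_pos hε))
    simpa [Real.dist_eq] using this
  -- Within block `b` the power `k^{-γ}` varies by a factor of at least `(b/(b+1))^γ`, whatever the
  -- block length; hence uniformity in `m`.
  have h2 : ∀ᶠ b : ℕ in atTop, κ * (1 - ((b : ℝ) / (b + 1)) ^ γ) ≤ ε / 2 := by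
    have h3 : Tendsto (fun b : ℕ => κ * (1 - ((b : ℝ) / (b + 1)) ^ γ)) atTop
        (𝓝 (κ * (1 - (1 : ℝ) ^ γ))) :=
      ((tendsto_natCast_div_add_atTop (1 : ℝ)).rpow_const (Or.inr hγ.le)).const_sub 1
        |>.const_mul κ
    exact h3.eventually (ge_mem_nhds (by simpa using hε))
  obtain ⟨K1, hK1⟩ := eventually_atTop.mp h1
  obtain ⟨K2, hK2⟩ := eventually_atTop.mp h2
  filter_upwards [eventually_ge_atTop (max (max K1 K2) 1)] with K hK m hm b hb k hk hk'
  have hK1' : K1 ≤ k := by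
    calc K1 ≤ m := by omega
      _ ≤ b * m := Nat.le_mul_of_pos_left m (by omega)
      _ ≤ k := hk
  have hb0 : (0 : ℝ) < b := by exact_mod_cast (by omega : 0 < b)
  have hm0 : (0 : ℝ) < m := by exact_mod_cast (by omega : 0 < m)
  have hbm : (0 : ℝ) < b * m := by positivity
  have hkR : (b : ℝ) * m ≤ k := by exact_mod_cast hk
  have hk'R : (k : ℝ) ≤ (b + 1) * m := by exact_mod_cast hk'.le
  have hk0 : (0 : ℝ) < k := hbm.trans_le hkR
  have e1 : |c k - κ * (k : ℝ) ^ (-γ)| ≤ ε / 2 * ((b : ℝ) * m) ^ (-γ) := by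
    have : c k - κ * (k : ℝ) ^ (-γ) = (c k * (k : ℝ) ^ γ - κ) * (k : ℝ) ^ (-γ) := by
      rw [sub_mul, mul_assoc, ← Real.rpow_add hk0, add_neg_cancel, Real.rpow_zero, mul_one]
    rw [this, abs_mul, abs_of_pos (Real.rpow_pos_of_pos hk0 _)]
    exact mul_le_mul (hK1 k hK1') (Real.rpow_le_rpow_of_nonpos hbm hkR (by linarith))
      (by positivity) (by positivity)
  have e2 : |κ * (k : ℝ) ^ (-γ) - κ * ((b : ℝ) * m) ^ (-γ)| ≤ ε / 2 * ((b : ℝ) * m) ^ (-γ) := by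
    have h4 : (k : ℝ) ^ (-γ) ≤ ((b : ℝ) * m) ^ (-γ) :=
      Real.rpow_le_rpow_of_nonpos hbm hkR (by linarith)
    rw [abs_sub_comm, abs_of_nonneg (by rw [sub_nonneg]; gcongr)]
    have h5 : ((b : ℝ) / (b + 1)) ^ γ * ((b : ℝ) * m) ^ (-γ) ≤ (k : ℝ) ^ (-γ) := by
      have : ((b : ℝ) / (b + 1)) ^ γ * ((b : ℝ) * m) ^ (-γ) = (((b : ℝ) + 1) * m) ^ (-γ) := by
        rw [Real.rpow_neg hbm.le, Real.rpow_neg (by positivity), ← Real.inv_rpow hbm.le,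
          ← Real.mul_rpow (by positivity) (by positivity), ← Real.inv_rpow (by positivity)]
        congr 1
        field_simp
      rw [this]
      exact Real.rpow_le_rpow_of_nonpos hk0 hk'R (by linarith)
    have h6 := hK2 b (by omega)
    calc κ * ((b : ℝ) * m) ^ (-γ) - κ * (k : ℝ) ^ (-γ)
        ≤ κ * ((b : ℝ) * m) ^ (-γ) - κ * (((b : ℝ) / (b + 1)) ^ γ * ((b : ℝ) * m) ^ (-γ)) := by
          gcongr
      _ = κ * (1 - ((b : ℝ) / (b + 1)) ^ γ) * ((b : ℝ) * m) ^ (-γ) := by ring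
      _ ≤ _ := by gcongr
  calc |c k - κ * ((b : ℝ) * m) ^ (-γ)|
      ≤ |c k - κ * (k : ℝ) ^ (-γ)| + |κ * (k : ℝ) ^ (-γ) - κ * ((b : ℝ) * m) ^ (-γ)| :=
        abs_sub_le _ _ _
    _ ≤ _ := by linarith

section BlockApproximation

variable {H : Type*} [NormedAddCommGroup H] [InnerProductSpace ℂ H]

/-- Three scales `B`, `N = QB`, `B + M = Q²B` are used. Blocks before `B` are few compared with `N`,
weights beyond `Q²B` are small compared with `(Nm)^{-γ}`, and between them the weights are frozen.
The constants are chosen in the order `Q`, `ε₁`, `B`, and `m` tends to infinity last. -/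
lemma exists_normLEOffDim_sub_blockModel (e : HilbertBasis ℕ ℂ H) {κ γ : ℝ} (hγ : 0 < γ)
    (hκ : 0 < κ) {J : Finset ℤ} {a : ℤ → ℂ} {A : ℤ → H →L[ℂ] H} {c : ℤ → ℕ → ℝ}
    (hA : ∀ j, ∀ k i : ℕ, (k : ℤ) + j = i → A j (e k) = (c j k : ℂ) • e i)
    (hc : ∀ j, Tendsto (fun k : ℕ => c j k * (k : ℝ) ^ γ) atTop (𝓝 κ))
    {ε δ : ℝ} (hε : 0 < ε) (hδ : 0 < δ) (R : ℝ) :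
    ∃ N B M : ℕ, 0 < B ∧ 0 < N ∧ 1 ≤ δ * N ∧ B ≤ δ * N ∧ R * N ≤ (B + M : ℕ) ∧
      ∀ᶠ m : ℕ in atTop, ∃ r : ℕ, (r : ℝ) ≤ 2 * δ * N * m ∧
        NormLEOffDim ((∑ j ∈ J, a j • A j) - blockModel e κ γ (trigPoly J a) m B M) r
          (ε * ((N : ℝ) * m) ^ (-γ)) := by
  set s := ∑ j ∈ J, ‖a j‖ with hs
  have hs0 : 0 ≤ s := Finset.sum_nonneg fun _ _ => norm_nonneg _
  obtain ⟨Q, hQ1, hQδ, hQR, hQε⟩ : ∃ Q : ℕ, 1 ≤ Q ∧ 1 ≤ δ * Q ∧ R ≤ Q ∧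
      s * ((κ + 1) * (Q : ℝ) ^ (-γ)) ≤ ε := by
    have h1 : Tendsto (fun Q : ℕ => s * ((κ + 1) * (Q : ℝ) ^ (-γ))) atTop
        (𝓝 (s * ((κ + 1) * 0))) :=
      (((tendsto_rpow_neg_atTop hγ).comp tendsto_natCast_atTop_atTop).const_mul _).const_mul _
    have h2 : Tendsto (fun Q : ℕ => δ * (Q : ℝ)) atTop atTop :=
      tendsto_natCast_atTop_atTop.const_mul_atTop hδ
    obtain ⟨Q, h⟩ := ((eventually_ge_atTop 1).and ((h2.eventually_ge_atTop 1).and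
      ((tendsto_natCast_atTop_atTop.eventually_ge_atTop R).and
      (h1.eventually (ge_mem_nhds (by simpa using hε)))))).exists
    exact ⟨Q, h⟩
  have hQ0 : (0 : ℝ) < Q := by exact_mod_cast hQ1
  -- The freezing error is relative to `(Bm)^{-γ} = Q^γ (Nm)^{-γ}`, hence the factor `Q^{-γ}`. The
  -- cap `1` gives the tail bound with constant `κ + 1`.
  set ε₁ := min 1 (ε * (Q : ℝ) ^ (-γ) / (s + 1)) with hε₁
  have hε₁0 : 0 < ε₁ := by positivity
  have hsε₁ : s * ε₁ ≤ ε * (Q : ℝ) ^ (-γ) := by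
    calc s * ε₁ ≤ (s + 1) * (ε * (Q : ℝ) ^ (-γ) / (s + 1)) := by
          gcongr
          · linarith
          · exact min_le_right _ _
      _ = _ := by field_simp
  have hev : ∀ᶠ K : ℕ in atTop, ∀ j ∈ J, ∀ m, K ≤ m → ∀ b, K ≤ b → ∀ k, b * m ≤ k →
      k < (b + 1) * m → |c j k - κ * ((b : ℝ) * m) ^ (-γ)| ≤ ε₁ * ((b : ℝ) * m) ^ (-γ) := by
    rw [eventually_all_finset]
    exact fun j _ => eventually_abs_sub_block_le hγ hκ (hc j) hε₁0
  obtain ⟨B, hB1, hB⟩ := ((eventually_ge_atTop 1).and hev).exists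
  have hB0 : (0 : ℝ) < B := by exact_mod_cast hB1
  set d := J.sup Int.natAbs
  have hd : ∀ j ∈ J, |j| ≤ d := fun j hj => by
    rw [Int.abs_eq_natAbs]
    exact_mod_cast Finset.le_sup (f := Int.natAbs) hj
  have hBM : B + (Q ^ 2 * B - B) = Q ^ 2 * B :=
    Nat.add_sub_cancel' (Nat.le_mul_of_pos_left B (by positivity))
  refine ⟨Q * B, B, Q ^ 2 * B - B, hB1, by positivity, ?_, ?_, ?_, ?_⟩
  · have : (1 : ℝ) ≤ B := by exact_mod_cast hB1
    push_cast
    nlinarith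
  · push_cast
    nlinarith
  · rw [hBM]
    push_cast
    calc R * (Q * B) ≤ Q * (Q * B) := by gcongr
      _ = _ := by ring
  -- The number of edge indices does not depend on `m`, so it is negligible against `Nm`.
  have hlarge : ∀ᶠ m : ℕ in atTop,
      ((B + (Q ^ 2 * B - B) + 1) * (2 * d) : ℕ) ≤ δ * ((Q * B : ℕ) : ℝ) * m :=
    (tendsto_natCast_atTop_atTop.const_mul_atTop (by positivity)).eventually_ge_atTop _
  filter_upwards [hlarge, eventually_ge_atTop B, eventually_ge_atTop d] with m hm1 hm2 hm3
  have hm0 : 0 < m := by omega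
  have hm0' : (0 : ℝ) < m := by exact_mod_cast hm0
  refine ⟨B * m + (B + (Q ^ 2 * B - B) + 1) * (2 * d), ?_, ?_⟩
  · have : (B : ℝ) * m ≤ δ * ((Q * B : ℕ) : ℝ) * m := by
      push_cast
      gcongr
      nlinarith
    rw [Nat.cast_add, Nat.cast_mul]
    linarith
  have hNm : (((Q * B : ℕ) : ℝ) * m) ^ (-γ) = (Q : ℝ) ^ (-γ) * ((B : ℝ) * m) ^ (-γ) := by
    push_cast
    rw [mul_assoc, Real.mul_rpow hQ0.le (by positivity)]
  have hP : (0 : ℝ) < ((B : ℝ) * m) ^ (-γ) := by positivity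
  refine (normLEOffDim_sub_blockModel e (ε := max (ε₁ * ((B : ℝ) * m) ^ (-γ))
    ((κ + 1) * (((Q ^ 2 * B : ℕ) : ℝ) * m) ^ (-γ))) (by positivity) hA hB1 hm0 hm3 hd ?_ ?_).mono
    le_rfl ?_
  · intro j hj b hb _ k hk hk'
    refine (hB j hj m hm2 b hb k hk hk').trans (le_max_of_le_left ?_)
    gcongr ε₁ * ?_
    exact Real.rpow_le_rpow_of_nonpos (by positivity) (by gcongr) (by linarith)
  · intro j hj k hk
    rw [hBM] at hk
    refine le_max_of_le_right ?_
    have hkb : k / m * m + k % m = k := Nat.div_add_mod' k m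
    have hkm : k % m < m := Nat.mod_lt _ hm0
    have hb : Q ^ 2 * B ≤ k / m := (Nat.le_div_iff_mul_le hm0).mpr hk
    have hb2 : B ≤ k / m := le_trans (Nat.le_mul_of_pos_left B (by positivity)) hb
    have h3 := hB j hj m hm2 (k / m) hb2 k (by omega) (by
      have : (k / m + 1) * m = k / m * m + m := by ring
      omega)
    set b := k / m
    have hb0 : (0 : ℝ) < b := by
      have : 0 < b := by omega
      exact_mod_cast this
    have h4 : |c j k| ≤ (κ + 1) * ((b : ℝ) * m) ^ (-γ) := by
      have h5 : |κ * ((b : ℝ) * m) ^ (-γ)| = κ * ((b : ℝ) * m) ^ (-γ) :=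
        abs_of_nonneg (by positivity)
      have h6 : ε₁ * ((b : ℝ) * m) ^ (-γ) ≤ 1 * ((b : ℝ) * m) ^ (-γ) := by
        gcongr
        exact min_le_left _ _
      have h7 := abs_sub_abs_le_abs_sub (c j k) (κ * ((b : ℝ) * m) ^ (-γ))
      rw [h5] at h7
      linarith
    refine h4.trans ?_
    gcongr (κ + 1) * ?_
    exact Real.rpow_le_rpow_of_nonpos (by positivity) (by gcongr) (by linarith)
  · rw [← hs, mul_max_of_nonneg _ _ hs0]
    refine max_le ?_ ?_
    · rw [hNm]
      calc s * (ε₁ * ((B : ℝ) * m) ^ (-γ)) = s * ε₁ * ((B : ℝ) * m) ^ (-γ) := by ring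
        _ ≤ ε * (Q : ℝ) ^ (-γ) * ((B : ℝ) * m) ^ (-γ) := by gcongr
        _ = _ := by ring
    · have : (((Q ^ 2 * B : ℕ) : ℝ) * m) ^ (-γ) =
          (Q : ℝ) ^ (-γ) * (((Q * B : ℕ) : ℝ) * m) ^ (-γ) := by
        rw [← Real.mul_rpow hQ0.le (by positivity)]
        congr 1
        push_cast
        ring
      rw [this]
      calc s * ((κ + 1) * ((Q : ℝ) ^ (-γ) * (((Q * B : ℕ) : ℝ) * m) ^ (-γ)))
          = s * ((κ + 1) * (Q : ℝ) ^ (-γ)) * (((Q * B : ℕ) : ℝ) * m) ^ (-γ) := by ring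
        _ ≤ _ := by gcongr

end BlockApproximation

/-! ### Riemann sums on the circle. -/

/-- The mean of a function over the unit circle. -/
noncomputable def circleMean (G : Circle → ℝ) : ℝ :=
  (2 * Real.pi)⁻¹ * ∫ θ in (0 : ℝ)..(2 * Real.pi), G (Circle.exp θ)

lemma circleMean_eq_integral_unit (G : Circle → ℝ) :
    circleMean G = ∫ x in (0 : ℝ)..1, G (Circle.exp (2 * Real.pi * x)) := by
  rw [circleMean, intervalIntegral.integral_comp_mul_left (fun θ => G (Circle.exp θ))
    (by positivity)]
  simp

/-- Riemann sums over the roots of unity. -/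
lemma tendsto_sum_rootOfUnityPoint {G : Circle → ℝ} (hG : Continuous G) :
    Tendsto (fun m : ℕ => (∑ l : Fin m, G (rootOfUnityPoint m l)) / m) atTop
      (𝓝 (circleMean G)) := by
  rw [circleMean_eq_integral_unit]
  set g : ℝ → ℝ := fun x => G (Circle.exp (2 * Real.pi * x)) with hg
  have hgc : Continuous g := by fun_prop
  have huc : UniformContinuousOn g (Set.Icc 0 1) :=
    isCompact_Icc.uniformContinuousOn_of_continuous hgc.continuousOn
  rw [Metric.tendsto_atTop]
  intro ε hε
  obtain ⟨δ, hδ, huc⟩ := Metric.uniformContinuousOn_iff_le.mp huc (ε / 2) (half_pos hε)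
  obtain ⟨n, hn⟩ := exists_nat_one_div_lt hδ
  refine ⟨n + 1, fun m hm => ?_⟩
  have hm0 : (0 : ℝ) < m := by exact_mod_cast (by omega : 0 < m)
  have hmδ : 1 / (m : ℝ) ≤ δ := by
    refine le_trans ?_ hn.le
    exact one_div_le_one_div_of_le (by positivity) (by exact_mod_cast hm)
  have hint : ∀ a b : ℝ, IntervalIntegrable g volume a b := fun a b => hgc.intervalIntegrable a b
  have h1 : ∫ x in (0 : ℝ)..1, g x =
      ∑ l ∈ Finset.range m, ∫ x in ((l : ℝ) / m)..((l + 1 : ℕ) : ℝ) / m, g x := by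
    rw [intervalIntegral.sum_integral_adjacent_intervals (a := fun l : ℕ => (l : ℝ) / m)
      fun k _ => hint _ _]
    simp [hm0.ne']
  have h2 : (∑ l : Fin m, G (rootOfUnityPoint m l)) / m =
      ∑ l ∈ Finset.range m, ∫ x in ((l : ℝ) / m)..((l + 1 : ℕ) : ℝ) / m, g ((l : ℝ) / m) := by
    rw [Fin.sum_univ_eq_sum_range (fun l => G (rootOfUnityPoint m l)) m, Finset.sum_div]
    refine Finset.sum_congr rfl fun l _ => ?_
    rw [intervalIntegral.integral_const, smul_eq_mul]
    simp only [hg, rootOfUnityPoint]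
    push_cast
    field_simp
    ring
  rw [Real.dist_eq, h1, h2, ← Finset.sum_sub_distrib]
  refine (Finset.abs_sum_le_sum_abs _ _).trans_lt ?_
  have h3 : ∀ l ∈ Finset.range m, |(∫ x in ((l : ℝ) / m)..((l + 1 : ℕ) : ℝ) / m, g ((l : ℝ) / m)) -
      ∫ x in ((l : ℝ) / m)..((l + 1 : ℕ) : ℝ) / m, g x| ≤ ε / 2 * (1 / m) := by
    intro l hl
    have hl' : ((l : ℝ) + 1) ≤ m := by exact_mod_cast Finset.mem_range.mp hl
    rw [← intervalIntegral.integral_sub (by simp) (hint _ _), ← Real.norm_eq_abs]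
    have hle : (l : ℝ) / m ≤ ((l + 1 : ℕ) : ℝ) / m := by gcongr; simp
    have hlen : ((l + 1 : ℕ) : ℝ) / m - (l : ℝ) / m = 1 / m := by push_cast; ring
    refine (intervalIntegral.norm_integral_le_of_norm_le_const (C := ε / 2) ?_).trans ?_
    · intro x hx
      rw [Set.uIoc_of_le hle] at hx
      have hx1 : ((l + 1 : ℕ) : ℝ) / m ≤ 1 := by
        rw [div_le_one hm0]; push_cast; exact hl'
      have hl0 : 0 ≤ (l : ℝ) / m := by positivity
      rw [← dist_eq_norm]
      refine huc _ ⟨hl0, hle.trans hx1⟩ _ ⟨hl0.trans hx.1.le, hx.2.trans hx1⟩ ?_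
      rw [dist_comm, Real.dist_eq, abs_of_nonneg (by linarith [hx.1])]
      linarith [hx.2]
    · rw [hlen, abs_of_nonneg (by positivity)]
  calc _ ≤ ∑ l ∈ Finset.range m, ε / 2 * (1 / m) := Finset.sum_le_sum h3
    _ = ε / 2 := by
      rw [Finset.sum_const, Finset.card_range, nsmul_eq_mul]
      field_simp
    _ < ε := half_lt_self hε

/-! ### Counting the eigenvalues of the block model. -/

section Counting

variable {H : Type*} [NormedAddCommGroup H] [InnerProductSpace ℂ H]

lemma card_filter_block_lt_le (B M : ℕ) {X : ℝ} (hX : 0 ≤ X) :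
    ((Finset.univ.filter fun y : Fin M => ((B + y : ℕ) : ℝ) < X).card : ℝ) ≤ X + 1 := by
  have h : (Finset.univ.filter fun y : Fin M => ((B + y : ℕ) : ℝ) < X).card ≤ ⌊X⌋₊ + 1 := by
    rw [← Finset.card_range (⌊X⌋₊ + 1)]
    refine Finset.card_le_card_of_injOn (fun y : Fin M => B + (y : ℕ)) ?_ ?_
    · intro y hy
      have : ((B + y : ℕ) : ℝ) < X := by simpa using hy
      simpa [Nat.lt_succ_iff] using Nat.le_floor this.le
    · intro y _ y' _ h
      exact Fin.ext (by simpa using h)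
  calc _ ≤ ((⌊X⌋₊ + 1 : ℕ) : ℝ) := by exact_mod_cast h
    _ ≤ _ := by push_cast; linarith [Nat.floor_le hX]

lemma sub_le_card_filter_block_le (B M : ℕ) {X : ℝ} (hM : X ≤ (B + M : ℕ)) :
    X - B ≤ ((Finset.univ.filter fun y : Fin M => ((B + y : ℕ) : ℝ) ≤ X).card : ℝ) := by
  have h : ⌈X⌉₊ - B ≤ (Finset.univ.filter fun y : Fin M => ((B + y : ℕ) : ℝ) ≤ X).card := by
    rw [← Finset.card_range (⌈X⌉₊ - B)]
    have hc : ⌈X⌉₊ ≤ B + M := Nat.ceil_le.mpr hM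
    refine Finset.card_le_card_of_surjOn (fun y : Fin M => (y : ℕ)) ?_
    intro y hy
    have hy' : y < ⌈X⌉₊ - B := by simpa using hy
    refine ⟨⟨y, by omega⟩, ?_, rfl⟩
    have : ((B + y : ℕ) : ℝ) < X := Nat.lt_ceil.mp (by omega)
    simpa using this.le
  have h1 : X ≤ ⌈X⌉₊ := Nat.le_ceil X
  have h2 : (⌈X⌉₊ : ℝ) ≤ (⌈X⌉₊ - B : ℕ) + B := by exact_mod_cast (by omega)
  have h3 : ((⌈X⌉₊ - B : ℕ) : ℝ) ≤
    ((Finset.univ.filter fun y : Fin M => ((B + y : ℕ) : ℝ) ≤ X).card : ℝ) := by exact_mod_cast h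
  linarith

/-- The block length `m` cancels, so at each root of unity the condition on the block number has a
threshold proportional to `N` only. -/
lemma lt_mul_rpow_neg_iff {κ σ γ b N m t : ℝ} (hγ : 0 < γ) (hσ : 0 < σ) (hκ : 0 < κ)
    (hb : 0 < b) (hN : 0 < N) (hm : 0 < m) (ht : 0 ≤ t) :
    σ * (N * m) ^ (-γ) < κ * (b * m) ^ (-γ) * t ↔ b < N * (κ * t / σ) ^ (1 / γ) := by
  have h1 : b < N * (κ * t / σ) ^ (1 / γ) ↔ (b / N) ^ γ < κ * t / σ := by
    rw [← div_lt_iff₀' hN, one_div, Real.lt_rpow_inv_iff_of_pos (by positivity) (by positivity) hγ]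
  rw [h1, Real.mul_rpow hN.le hm.le, Real.mul_rpow hb.le hm.le, lt_div_iff₀ hσ,
    Real.div_rpow hb.le hN.le, Real.rpow_neg hN.le, Real.rpow_neg hb.le]
  have hbγ : 0 < b ^ γ := by positivity
  have hNγ : 0 < N ^ γ := by positivity
  have hmγ : 0 < m ^ (-γ) := by positivity
  rw [show σ * ((N ^ γ)⁻¹ * m ^ (-γ)) = (b ^ γ / N ^ γ * σ) * (m ^ (-γ) * (b ^ γ)⁻¹) by
      field_simp,
    show κ * ((b ^ γ)⁻¹ * m ^ (-γ)) * t = κ * t * (m ^ (-γ) * (b ^ γ)⁻¹) by ring,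
    mul_lt_mul_iff_left₀ (by positivity)]

lemma le_mul_rpow_neg_iff {κ σ γ b N m t : ℝ} (hγ : 0 < γ) (hσ : 0 < σ) (hκ : 0 < κ)
    (hb : 0 < b) (hN : 0 < N) (hm : 0 < m) (ht : 0 ≤ t) :
    σ * (N * m) ^ (-γ) ≤ κ * (b * m) ^ (-γ) * t ↔ b ≤ N * (κ * t / σ) ^ (1 / γ) := by
  have h1 : b ≤ N * (κ * t / σ) ^ (1 / γ) ↔ (b / N) ^ γ ≤ κ * t / σ := by
    rw [← div_le_iff₀' hN, one_div, Real.le_rpow_inv_iff_of_pos (by positivity) (by positivity) hγ]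
  rw [h1, Real.mul_rpow hN.le hm.le, Real.mul_rpow hb.le hm.le, le_div_iff₀ hσ,
    Real.div_rpow hb.le hN.le, Real.rpow_neg hN.le, Real.rpow_neg hb.le]
  have hbγ : 0 < b ^ γ := by positivity
  have hNγ : 0 < N ^ γ := by positivity
  have hmγ : 0 < m ^ (-γ) := by positivity
  rw [show σ * ((N ^ γ)⁻¹ * m ^ (-γ)) = (b ^ γ / N ^ γ * σ) * (m ^ (-γ) * (b ^ γ)⁻¹) by
      field_simp,
    show κ * ((b ^ γ)⁻¹ * m ^ (-γ)) * t = κ * t * (m ^ (-γ) * (b ^ γ)⁻¹) by ring,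
    mul_le_mul_iff_left₀ (by positivity)]

/-- The rescaled symbol `(κ |p| / σ)^{1/γ}`. -/
noncomputable def rescaledSymbol (κ σ γ : ℝ) (p : Circle → ℂ) (ζ : Circle) : ℝ :=
  (κ * ‖p ζ‖ / σ) ^ (1 / γ)

lemma card_filter_prod_eq_sum {M m : ℕ} (P : Fin M × Fin m → Prop) [DecidablePred P] :
    (Finset.univ.filter P).card =
      ∑ l : Fin m, (Finset.univ.filter fun y : Fin M => P (y, l)).card := by
  simp only [Finset.card_filter, Fintype.sum_prod_type]
  exact Finset.sum_comm

/-- For each root of unity, the blocks whose eigenvalue exceeds the level are those below a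
threshold; rounding costs at most one block per root, `m` in all. -/
lemma normLEOffDim_blockModel {e : ℕ → H} (he : Orthonormal ℂ e) {κ γ σ : ℝ} (hγ : 0 < γ)
    (hκ : 0 < κ) (hσ : 0 < σ) (p : Circle → ℂ) {m N B : ℕ} (M : ℕ) (hm : 0 < m) (hN : 0 < N)
    (hB : 0 < B) :
    ∃ r : ℕ, (r : ℝ) ≤ N * ∑ l : Fin m, rescaledSymbol κ σ γ p (rootOfUnityPoint m l) + m ∧
      NormLEOffDim (blockModel e κ γ p m B M) r (σ * ((N : ℝ) * m) ^ (-γ)) := by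
  classical
  have hm0 : (0 : ℝ) < m := by exact_mod_cast hm
  have hN0 : (0 : ℝ) < N := by exact_mod_cast hN
  refine ⟨_, ?_, normLEOffDim_diagOp (orthonormal_blockFourier he hm B M) _ (by positivity)⟩
  rw [card_filter_prod_eq_sum, Nat.cast_sum]
  have h : ∀ l : Fin m, ((Finset.univ.filter fun y : Fin M => σ * ((N : ℝ) * m) ^ (-γ) <
      ‖((κ * (((B + y : ℕ) : ℝ) * m) ^ (-γ) : ℝ) : ℂ) * p (rootOfUnityPoint m l)‖).card : ℝ) ≤
      N * rescaledSymbol κ σ γ p (rootOfUnityPoint m l) + 1 := by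
    intro l
    refine le_trans (le_of_eq ?_) (card_filter_block_lt_le B M
      (X := N * rescaledSymbol κ σ γ p (rootOfUnityPoint m l))
      (by rw [rescaledSymbol]; positivity))
    congr 2
    ext y
    have hb0 : (0 : ℝ) < (B + y : ℕ) := by exact_mod_cast (by omega : 0 < B + (y : ℕ))
    simp only [Finset.mem_filter, Finset.mem_univ, true_and]
    rw [norm_mul, Complex.norm_real, Real.norm_of_nonneg (by positivity),
      lt_mul_rpow_neg_iff hγ hσ hκ hb0 hN0 hm0 (norm_nonneg _), rescaledSymbol]
  refine (Finset.sum_le_sum fun l _ => h l).trans (le_of_eq ?_)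
  rw [Finset.sum_add_distrib, ← Finset.mul_sum]
  simp

/-- The same count from below. The missing blocks before `B` cost `B` per root, and `hM` ensures
that the thresholds do not pass the last block. -/
lemma normGEOnDim_blockModel {e : ℕ → H} (he : Orthonormal ℂ e) {κ γ σ : ℝ} (hγ : 0 < γ)
    (hκ : 0 < κ) (hσ : 0 < σ) (p : Circle → ℂ) {m N B M : ℕ} (hm : 0 < m) (hN : 0 < N)
    (hB : 0 < B) (hM : ∀ ζ, N * rescaledSymbol κ σ γ p ζ ≤ (B + M : ℕ)) :
    ∃ r : ℕ, N * ∑ l : Fin m, rescaledSymbol κ σ γ p (rootOfUnityPoint m l) - B * m ≤ r ∧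
      NormGEOnDim (blockModel e κ γ p m B M) r (σ * ((N : ℝ) * m) ^ (-γ)) := by
  classical
  have hm0 : (0 : ℝ) < m := by exact_mod_cast hm
  have hN0 : (0 : ℝ) < N := by exact_mod_cast hN
  refine ⟨_, ?_, normGEOnDim_diagOp (orthonormal_blockFourier he hm B M) _ (by positivity)⟩
  rw [card_filter_prod_eq_sum, Nat.cast_sum]
  have h : ∀ l : Fin m, N * rescaledSymbol κ σ γ p (rootOfUnityPoint m l) - B ≤
      ((Finset.univ.filter fun y : Fin M => σ * ((N : ℝ) * m) ^ (-γ) ≤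
      ‖((κ * (((B + y : ℕ) : ℝ) * m) ^ (-γ) : ℝ) : ℂ) * p (rootOfUnityPoint m l)‖).card : ℝ) := by
    intro l
    refine (sub_le_card_filter_block_le B M
      (X := N * rescaledSymbol κ σ γ p (rootOfUnityPoint m l)) (hM _)).trans (le_of_eq ?_)
    congr 2
    ext y
    have hb0 : (0 : ℝ) < (B + y : ℕ) := by exact_mod_cast (by omega : 0 < B + (y : ℕ))
    simp only [Finset.mem_filter, Finset.mem_univ, true_and]
    rw [norm_mul, Complex.norm_real, Real.norm_of_nonneg (by positivity),
      le_mul_rpow_neg_iff hγ hσ hκ hb0 hN0 hm0 (norm_nonneg _), rescaledSymbol]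
  refine le_trans (le_of_eq ?_) (Finset.sum_le_sum fun l _ => h l)
  rw [Finset.sum_sub_distrib, ← Finset.mul_sum]
  simp [mul_comm]

lemma continuous_rescaledSymbol {κ σ γ : ℝ} (hγ : 0 < γ) {p : Circle → ℂ} (hp : Continuous p) :
    Continuous (rescaledSymbol κ σ γ p) := by
  unfold rescaledSymbol
  exact ((hp.norm.const_mul κ).div_const σ).rpow_const fun _ => Or.inr (by positivity)

lemma circleMean_rescaledSymbol {κ σ γ : ℝ} (hκ : 0 < κ) (hσ : 0 < σ) (p : Circle → ℂ) :
    circleMean (rescaledSymbol κ σ γ p) =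
      (κ / σ) ^ (1 / γ) * circleMean fun ζ => ‖p ζ‖ ^ (1 / γ) := by
  have : ∀ ζ, rescaledSymbol κ σ γ p ζ = (κ / σ) ^ (1 / γ) * ‖p ζ‖ ^ (1 / γ) := fun ζ => by
    rw [rescaledSymbol, ← Real.mul_rpow (by positivity) (norm_nonneg _)]
    congr 1
    ring
  simp only [circleMean, this, intervalIntegral.integral_const_mul]
  ring

lemma circleMean_nonneg {G : Circle → ℝ} (hG : ∀ ζ, 0 ≤ G ζ) : 0 ≤ circleMean G :=
  mul_nonneg (by positivity)
    (intervalIntegral.integral_nonneg (by positivity) fun _ _ => hG _)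

/-- The model has about `Nm` times this mean eigenvalues above the level, so a mean below `1` leaves
room among `Nm` dimensions for all errors. -/
lemma circleMean_rescaledSymbol_lt_one {κ σ γ : ℝ} (hγ : 0 < γ) (hκ : 0 < κ) (hσ : 0 < σ)
    {p : Circle → ℂ} (h : κ * (circleMean fun ζ => ‖p ζ‖ ^ (1 / γ)) ^ γ < σ) :
    circleMean (rescaledSymbol κ σ γ p) < 1 := by
  have hI : 0 ≤ circleMean fun ζ => ‖p ζ‖ ^ (1 / γ) := circleMean_nonneg fun _ => by positivity
  rw [circleMean_rescaledSymbol hκ hσ, ← Real.rpow_lt_rpow_iff (by positivity) zero_le_one hγ,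
    Real.mul_rpow (by positivity) hI, Real.one_rpow, ← Real.rpow_mul (by positivity),
    one_div_mul_cancel hγ.ne', Real.rpow_one, div_mul_eq_mul_div, div_lt_one hσ]
  exact h

lemma one_lt_circleMean_rescaledSymbol {κ σ γ : ℝ} (hγ : 0 < γ) (hκ : 0 < κ) (hσ : 0 < σ)
    {p : Circle → ℂ} (h : σ < κ * (circleMean fun ζ => ‖p ζ‖ ^ (1 / γ)) ^ γ) :
    1 < circleMean (rescaledSymbol κ σ γ p) := by
  have hI : 0 ≤ circleMean fun ζ => ‖p ζ‖ ^ (1 / γ) := circleMean_nonneg fun _ => by positivity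
  rw [circleMean_rescaledSymbol hκ hσ, ← Real.rpow_lt_rpow_iff zero_le_one (by positivity) hγ,
    Real.mul_rpow (by positivity) hI, Real.one_rpow, ← Real.rpow_mul (by positivity),
    one_div_mul_cancel hγ.ne', Real.rpow_one, div_mul_eq_mul_div, one_lt_div hσ]
  exact h

lemma continuous_trigPoly (J : Finset ℤ) (a : ℤ → ℂ) : Continuous (trigPoly J a) := by
  unfold trigPoly
  refine continuous_finsetSum _ fun j _ => continuous_const.mul ?_
  exact (show Continuous fun ζ : Circle => (ζ : ℂ) by fun_prop).zpow₀ j fun ζ => Or.inl (Circle.coe_ne_zero ζ)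

lemma exists_eventually_normLEOffDim (e : HilbertBasis ℕ ℂ H) {κ γ : ℝ} (hγ : 0 < γ)
    (hκ : 0 < κ) {J : Finset ℤ} {a : ℤ → ℂ} {A : ℤ → H →L[ℂ] H} {c : ℤ → ℕ → ℝ}
    (hA : ∀ j, ∀ k i : ℕ, (k : ℤ) + j = i → A j (e k) = (c j k : ℂ) • e i)
    (hc : ∀ j, Tendsto (fun k : ℕ => c j k * (k : ℝ) ^ γ) atTop (𝓝 κ)) {σ : ℝ}
    (hσ : κ * (circleMean fun ζ => ‖trigPoly J a ζ‖ ^ (1 / γ)) ^ γ < σ) :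
    ∃ N : ℕ, 0 < N ∧ ∀ᶠ m : ℕ in atTop,
      NormLEOffDim (∑ j ∈ J, a j • A j) (N * m) (σ * ((N : ℝ) * m) ^ (-γ)) := by
  obtain ⟨σ₁, h1, h2⟩ := exists_between hσ
  have hI : 0 ≤ circleMean fun ζ => ‖trigPoly J a ζ‖ ^ (1 / γ) :=
    circleMean_nonneg fun _ => by positivity
  have hσ₁ : 0 < σ₁ := lt_of_le_of_lt (by positivity) h1
  have hlt := circleMean_rescaledSymbol_lt_one hγ hκ hσ₁ h1
  set G := rescaledSymbol κ σ₁ γ (trigPoly J a) with hG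
  -- The four shares of `δ` pay for the Riemann sum (one), the rounding term `m ≤ δNm` (one) and the
  -- rank `2δNm` of the model error (two).
  obtain ⟨δ, hδ0, hδ⟩ : ∃ δ > 0, circleMean G + 4 * δ = 1 :=
    ⟨(1 - circleMean G) / 4, by linarith, by ring⟩
  obtain ⟨N, B, M, hB, hN, hN1, -, -, hev⟩ :=
    exists_normLEOffDim_sub_blockModel (J := J) (a := a) e hγ hκ hA hc (sub_pos.mpr h2) hδ0 0
  refine ⟨N, hN, ?_⟩
  have hR := tendsto_sum_rootOfUnityPoint (continuous_rescaledSymbol (κ := κ) (σ := σ₁) hγ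
    (continuous_trigPoly J a))
  filter_upwards [hev, hR.eventually (ge_mem_nhds (show circleMean G < circleMean G + δ by
    linarith)), eventually_gt_atTop 0] with m hm hmR hm0
  obtain ⟨r, hr, hrT⟩ := hm
  obtain ⟨r', hr', hrS⟩ := normLEOffDim_blockModel e.orthonormal hγ hκ hσ₁ (trigPoly J a) M hm0
    hN hB
  have hm0' : (0 : ℝ) < m := by exact_mod_cast hm0
  refine (hrS.of_sub hrT).mono ?_ (le_of_eq (by ring))
  rw [div_le_iff₀ hm0'] at hmR
  have h3 : (N : ℝ) * ∑ l : Fin m, G (rootOfUnityPoint m l) ≤ N * ((circleMean G + δ) * m) := by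
    gcongr
  have h4 : (m : ℝ) ≤ δ * N * m := le_mul_of_one_le_left hm0'.le hN1
  have : (r' : ℝ) + r ≤ N * m := by
    have h5 : (N : ℝ) * m = N * ((circleMean G + δ) * m) + 3 * (δ * N * m) := by
      rw [← sub_eq_zero]
      linear_combination (-(N : ℝ) * m) * hδ
    linarith
  exact_mod_cast this

lemma exists_eventually_normGEOnDim (e : HilbertBasis ℕ ℂ H) {κ γ : ℝ} (hγ : 0 < γ)
    (hκ : 0 < κ) {J : Finset ℤ} {a : ℤ → ℂ} {A : ℤ → H →L[ℂ] H} {c : ℤ → ℕ → ℝ}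
    (hA : ∀ j, ∀ k i : ℕ, (k : ℤ) + j = i → A j (e k) = (c j k : ℂ) • e i)
    (hc : ∀ j, Tendsto (fun k : ℕ => c j k * (k : ℝ) ^ γ) atTop (𝓝 κ)) {σ : ℝ} (hσ0 : 0 < σ)
    (hσ : σ < κ * (circleMean fun ζ => ‖trigPoly J a ζ‖ ^ (1 / γ)) ^ γ) :
    ∃ N : ℕ, 0 < N ∧ ∀ᶠ m : ℕ in atTop,
      NormGEOnDim (∑ j ∈ J, a j • A j) (N * m) (σ * ((N : ℝ) * m) ^ (-γ)) := by
  obtain ⟨σ₁, h1, h2⟩ := exists_between hσ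
  have hσ₁ : 0 < σ₁ := hσ0.trans h1
  have hlt := one_lt_circleMean_rescaledSymbol hγ hκ hσ₁ h2
  set G := rescaledSymbol κ σ₁ γ (trigPoly J a) with hG
  have hGc : Continuous G := continuous_rescaledSymbol hγ (continuous_trigPoly J a)
  -- The thresholds `N G ζ` are at most `R N`, so taking `B + M ≥ R N` makes the model long enough
  -- to contain every counted block.
  obtain ⟨R, hR⟩ : ∃ R, ∀ ζ, G ζ ≤ R := by
    obtain ⟨R, hR⟩ := (isCompact_range hGc).bddAbove
    exact ⟨R, fun ζ => hR ⟨ζ, rfl⟩⟩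
  -- One share for the Riemann sum, one for the `Bm ≤ δNm` initial indices, two for the rank of the
  -- model error.
  obtain ⟨δ, hδ0, hδ⟩ : ∃ δ > 0, circleMean G - 4 * δ = 1 :=
    ⟨(circleMean G - 1) / 4, by linarith, by ring⟩
  obtain ⟨N, B, M, hB, hN, hN1, hBN, hRN, hev⟩ :=
    exists_normLEOffDim_sub_blockModel (J := J) (a := a) e hγ hκ hA hc (sub_pos.mpr h1) hδ0 R
  refine ⟨N, hN, ?_⟩
  have hRi := tendsto_sum_rootOfUnityPoint hGc
  filter_upwards [hev, hRi.eventually (le_mem_nhds (show circleMean G - δ < circleMean G by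
    linarith)), eventually_gt_atTop 0] with m hm hmR hm0
  obtain ⟨r, hr, hrT⟩ := hm
  obtain ⟨r', hr', hrS⟩ := normGEOnDim_blockModel e.orthonormal hγ hκ hσ₁ (trigPoly J a) (M := M)
    hm0 hN hB (fun ζ => by
      refine le_trans ?_ hRN
      rw [mul_comm]
      gcongr
      exact hR ζ)
  have hm0' : (0 : ℝ) < m := by exact_mod_cast hm0
  rw [le_div_iff₀ hm0'] at hmR
  have h3 : (N : ℝ) * ((circleMean G - δ) * m) ≤ N * ∑ l : Fin m, G (rootOfUnityPoint m l) := by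
    gcongr
  have h4 : (B : ℝ) * m ≤ δ * N * m := by gcongr
  have h6 : N * m + r ≤ r' := by
    have h5 : (N : ℝ) * m = N * ((circleMean G - δ) * m) - 3 * (δ * N * m) := by
      rw [← sub_eq_zero]
      linear_combination (-(N : ℝ) * m) * hδ
    have : (N : ℝ) * m + r ≤ r' := by linarith
    exact_mod_cast this
  exact ((hrS.mono h6 le_rfl).of_sub hrT).mono le_rfl (le_of_eq (by ring))

end Counting

/-! ### From multiples of `N` and approximants to the full asymptotics. -/

lemma tendsto_mul_nat_div_div {N : ℕ} (hN : 0 < N) :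
    Tendsto (fun n : ℕ => ((N : ℝ) * (n / N : ℕ)) / n) atTop (𝓝 1) := by
  have hN' : (0 : ℝ) < N := by exact_mod_cast hN
  have h := (tendsto_nat_floor_div_atTop (R := ℝ)).comp
    (tendsto_natCast_atTop_atTop.atTop_div_const hN')
  refine h.congr fun n => ?_
  simp only [Function.comp, Nat.floor_div_eq_div]
  field_simp

lemma eventually_le_mul_rpow_neg {x : ℕ → ℝ} {γ σ σ' : ℝ}
    (hx : Tendsto (fun n : ℕ => x n / n) atTop (𝓝 1)) (h : σ < σ') :
    ∀ᶠ n : ℕ in atTop, σ * x n ^ (-γ) ≤ σ' * (n : ℝ) ^ (-γ) := by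
  have h1 : Tendsto (fun n : ℕ => σ * (x n / n) ^ (-γ)) atTop (𝓝 (σ * 1 ^ (-γ))) :=
    (hx.rpow_const (Or.inl one_ne_zero)).const_mul _
  rw [Real.one_rpow, mul_one] at h1
  filter_upwards [h1.eventually (ge_mem_nhds h), eventually_gt_atTop 0,
    hx.eventually (lt_mem_nhds zero_lt_one)] with n hn hn0 hx0
  have hn0' : (0 : ℝ) < n := by exact_mod_cast hn0
  have hxn : x n = x n / n * n := by field_simp
  calc σ * x n ^ (-γ) = σ * (x n / n) ^ (-γ) * (n : ℝ) ^ (-γ) := by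
        rw [mul_assoc, ← Real.mul_rpow hx0.le hn0'.le, ← hxn]
    _ ≤ _ := by gcongr

lemma eventually_mul_rpow_neg_le {x : ℕ → ℝ} {γ σ σ' : ℝ}
    (hx : Tendsto (fun n : ℕ => x n / n) atTop (𝓝 1)) (h : σ < σ') :
    ∀ᶠ n : ℕ in atTop, σ * (n : ℝ) ^ (-γ) ≤ σ' * x n ^ (-γ) := by
  have := eventually_le_mul_rpow_neg (γ := γ) hx (neg_lt_neg h)
  filter_upwards [this] with n hn
  linarith

section Asymptotics

variable {H : Type*} [NormedAddCommGroup H] [InnerProductSpace ℂ H]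

/-- Round `n` down to a multiple of `N`; since `N⌊n/N⌋ ~ n`, the power changes by a factor tending
to `1`, absorbed by `σ < σ'`. -/
lemma eventually_normLEOffDim_of_multiples {T : H →L[ℂ] H} {γ σ σ' : ℝ} {N : ℕ} (hN : 0 < N)
    (hσ : σ < σ')
    (h : ∀ᶠ m : ℕ in atTop, NormLEOffDim T (N * m) (σ * ((N : ℝ) * m) ^ (-γ))) :
    ∀ᶠ n : ℕ in atTop, NormLEOffDim T n (σ' * (n : ℝ) ^ (-γ)) := by
  filter_upwards [(Nat.tendsto_div_const_atTop hN.ne').eventually h,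
    eventually_le_mul_rpow_neg (γ := γ) (tendsto_mul_nat_div_div hN) hσ] with n hn hn'
  exact hn.mono (Nat.mul_div_le n N) hn'

/-- Here `n` is rounded up, to `N(⌊n/N⌋ + 1) ≥ n + 1`. -/
lemma eventually_normGEOnDim_of_multiples {T : H →L[ℂ] H} {γ σ σ' : ℝ} {N : ℕ} (hN : 0 < N)
    (hσ : σ' < σ)
    (h : ∀ᶠ m : ℕ in atTop, NormGEOnDim T (N * m) (σ * ((N : ℝ) * m) ^ (-γ))) :
    ∀ᶠ n : ℕ in atTop, NormGEOnDim T (n + 1) (σ' * (n : ℝ) ^ (-γ)) := by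
  have hlim : Tendsto (fun n : ℕ => ((N : ℝ) * ((n / N + 1 : ℕ) : ℝ)) / n) atTop (𝓝 1) := by
    have h1 := (tendsto_mul_nat_div_div hN).add
      (tendsto_const_nhds (x := (N : ℝ)).div_atTop tendsto_natCast_atTop_atTop)
    rw [add_zero] at h1
    refine h1.congr fun n => ?_
    push_cast
    ring
  have ht : Tendsto (fun n : ℕ => n / N + 1) atTop atTop :=
    (tendsto_add_atTop_nat 1).comp (Nat.tendsto_div_const_atTop hN.ne')
  filter_upwards [ht.eventually h, eventually_mul_rpow_neg_le (γ := γ) hlim hσ] with n hn hn'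
  refine hn.mono ?_ hn'
  have := Nat.lt_mul_div_succ n hN
  omega

/-- Spend `r ≤ δn` dimensions on the error and `n - r` on the approximant; the loss `(1-δ)^{-γ}` is
close to `1` for small `δ`. -/
lemma eventually_normLEOffDim_of_approx {T : H →L[ℂ] H} {γ σ σ' : ℝ} (hσ0 : 0 ≤ σ) (hσ : σ < σ')
    (h : ∀ δ : ℝ, 0 < δ → ∀ η : ℝ, 0 < η → ∃ T₁ : H →L[ℂ] H,
      (∀ᶠ n : ℕ in atTop, NormLEOffDim T₁ n (σ * (n : ℝ) ^ (-γ))) ∧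
      ∀ᶠ n : ℕ in atTop, ∃ r : ℕ, (r : ℝ) ≤ δ * n ∧
        NormLEOffDim (T - T₁) r (η * (n : ℝ) ^ (-γ))) (hγ : 0 < γ) :
    ∀ᶠ n : ℕ in atTop, NormLEOffDim T n (σ' * (n : ℝ) ^ (-γ)) := by
  obtain ⟨σ₁, h1, h2⟩ := exists_between hσ
  obtain ⟨δ, ⟨hδ0, hδ1⟩, hδ⟩ : ∃ δ : ℝ, (0 < δ ∧ δ < 1) ∧ σ * (1 - δ) ^ (-γ) ≤ σ₁ := by
    have hcont : Tendsto (fun δ : ℝ => σ * (1 - δ) ^ (-γ)) (𝓝[>] 0) (𝓝 (σ * (1 - 0) ^ (-γ))) := by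
      refine (((tendsto_id.const_sub 1).rpow_const ?_).const_mul σ).mono_left nhdsWithin_le_nhds
      left; simp
    rw [sub_zero, Real.one_rpow, mul_one] at hcont
    obtain ⟨δ, hδ, hδ'⟩ := ((hcont.eventually (ge_mem_nhds h1)).and
      (Ioo_mem_nhdsGT (zero_lt_one (α := ℝ)))).exists
    exact ⟨δ, hδ', hδ⟩
  obtain ⟨T₁, hT₁, hT⟩ := h δ hδ0 (σ' - σ₁) (by linarith)
  obtain ⟨n₀, hn₀⟩ := eventually_atTop.mp hT₁
  have hlarge : ∀ᶠ n : ℕ in atTop, (n₀ : ℝ) ≤ (1 - δ) * n :=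
    (tendsto_natCast_atTop_atTop.const_mul_atTop (by linarith)).eventually_ge_atTop _
  filter_upwards [hT, hlarge, eventually_gt_atTop 0] with n hn hnn hn0
  obtain ⟨r, hr, hrT⟩ := hn
  have hn0' : (0 : ℝ) < n := by exact_mod_cast hn0
  have hrn : r ≤ n := by
    have : (r : ℝ) ≤ n := by nlinarith
    exact_mod_cast this
  have hcast : ((n - r : ℕ) : ℝ) = n - r := Nat.cast_sub hrn
  have hge : n₀ ≤ n - r := by
    have : (n₀ : ℝ) ≤ (n - r : ℕ) := by rw [hcast]; linarith
    exact_mod_cast this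
  refine ((hn₀ _ hge).of_sub hrT).mono (by omega) ?_
  have : σ * ((n - r : ℕ) : ℝ) ^ (-γ) ≤ σ₁ * (n : ℝ) ^ (-γ) := by
    calc σ * ((n - r : ℕ) : ℝ) ^ (-γ) ≤ σ * ((1 - δ) * n) ^ (-γ) := by
          refine mul_le_mul_of_nonneg_left (Real.rpow_le_rpow_of_nonpos ?_ ?_ (by linarith)) hσ0
          · have : 0 < 1 - δ := by linarith
            positivity
          · rw [hcast]; linarith
      _ = σ * (1 - δ) ^ (-γ) * (n : ℝ) ^ (-γ) := by
          rw [Real.mul_rpow (by linarith) hn0'.le, mul_assoc]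
      _ ≤ _ := by gcongr
  linarith [sub_mul σ' σ₁ ((n : ℝ) ^ (-γ))]

/-- The approximant is used at `n + r`, so that `n + 1` dimensions survive the removal of `r`; the
loss is `(1+δ)^{-γ}`. -/
lemma eventually_normGEOnDim_of_approx {T : H →L[ℂ] H} {γ σ σ' : ℝ} (hσ0 : 0 ≤ σ) (hσ : σ' < σ)
    (h : ∀ δ : ℝ, 0 < δ → ∀ η : ℝ, 0 < η → ∃ T₁ : H →L[ℂ] H,
      (∀ᶠ n : ℕ in atTop, NormGEOnDim T₁ (n + 1) (σ * (n : ℝ) ^ (-γ))) ∧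
      ∀ᶠ n : ℕ in atTop, ∃ r : ℕ, (r : ℝ) ≤ δ * n ∧
        NormLEOffDim (T - T₁) r (η * (n : ℝ) ^ (-γ))) (hγ : 0 < γ) :
    ∀ᶠ n : ℕ in atTop, NormGEOnDim T (n + 1) (σ' * (n : ℝ) ^ (-γ)) := by
  obtain ⟨σ₁, h1, h2⟩ := exists_between hσ
  obtain ⟨δ, hδ0, hδ⟩ : ∃ δ : ℝ, 0 < δ ∧ σ₁ ≤ σ * (1 + δ) ^ (-γ) := by
    have hcont : Tendsto (fun δ : ℝ => σ * (1 + δ) ^ (-γ)) (𝓝[>] 0) (𝓝 (σ * (1 + 0) ^ (-γ))) := by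
      refine (((tendsto_id.const_add 1).rpow_const ?_).const_mul σ).mono_left nhdsWithin_le_nhds
      left; simp
    rw [add_zero, Real.one_rpow, mul_one] at hcont
    obtain ⟨δ, hδ, hδ'⟩ := ((hcont.eventually (le_mem_nhds h2)).and
      (self_mem_nhdsWithin)).exists
    exact ⟨δ, hδ', hδ⟩
  obtain ⟨T₁, hT₁, hT⟩ := h δ hδ0 (σ₁ - σ') (by linarith)
  obtain ⟨n₀, hn₀⟩ := eventually_atTop.mp hT₁
  filter_upwards [hT, eventually_ge_atTop n₀, eventually_gt_atTop 0] with n hn hnn hn0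
  obtain ⟨r, hr, hrT⟩ := hn
  have hn0' : (0 : ℝ) < n := by exact_mod_cast hn0
  have hGE := hn₀ (n + r) (by omega)
  rw [show n + r + 1 = n + 1 + r by ring] at hGE
  refine (hGE.of_sub hrT).mono le_rfl ?_
  have : σ₁ * (n : ℝ) ^ (-γ) ≤ σ * ((n + r : ℕ) : ℝ) ^ (-γ) := by
    calc σ₁ * (n : ℝ) ^ (-γ) ≤ σ * (1 + δ) ^ (-γ) * (n : ℝ) ^ (-γ) := by gcongr
      _ = σ * ((1 + δ) * n) ^ (-γ) := by
          rw [Real.mul_rpow (by linarith) hn0'.le, mul_assoc]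
      _ ≤ _ := by
          refine mul_le_mul_of_nonneg_left (Real.rpow_le_rpow_of_nonpos (by positivity) ?_
            (by linarith)) hσ0
          push_cast
          linarith
  linarith [sub_mul σ₁ σ' ((n : ℝ) ^ (-γ))]

lemma forall_exists_normLEOffDim_of_eventually {T : H →L[ℂ] H} {γ σ : ℝ} (hγ : 0 < γ)
    (h : ∀ᶠ n : ℕ in atTop, NormLEOffDim T n (σ * (n : ℝ) ^ (-γ))) (ε : ℝ) (hε : 0 < ε) :
    ∃ r, NormLEOffDim T r ε := by
  have h1 : Tendsto (fun n : ℕ => σ * (n : ℝ) ^ (-γ)) atTop (𝓝 (σ * 0)) :=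
    ((tendsto_rpow_neg_atTop hγ).comp tendsto_natCast_atTop_atTop).const_mul _
  obtain ⟨n, hn, hn'⟩ := (h.and (h1.eventually (ge_mem_nhds (by simpa using hε)))).exists
  exact ⟨n, hn.mono le_rfl hn'⟩

lemma isLittleO_singularValue [CompleteSpace H] {T : H →L[ℂ] H} {γ C : ℝ} (hγ : 0 < γ) (hC : 0 ≤ C)
    (hU : ∀ σ, C < σ → ∀ᶠ n : ℕ in atTop, NormLEOffDim T n (σ * (n : ℝ) ^ (-γ)))
    (hL : ∀ σ, 0 < σ → σ < C → ∀ᶠ n : ℕ in atTop,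
      NormGEOnDim T (n + 1) (σ * (n : ℝ) ^ (-γ))) :
    (fun n : ℕ => singularValue T n - C * (n : ℝ) ^ (-γ)) =o[atTop]
      (fun n : ℕ => (n : ℝ) ^ (-γ)) := by
  have hT := forall_exists_normLEOffDim_of_eventually hγ (hU (C + 1) (by linarith))
  rw [isLittleO_iff]
  intro ε hε
  have hlow : ∀ᶠ n : ℕ in atTop, (C - ε) * (n : ℝ) ^ (-γ) ≤ singularValue T n := by
    by_cases h : 0 < C - ε
    · filter_upwards [hL (C - ε) h (by linarith)] with n hn
      exact le_singularValue_of_normGEOnDim hT hn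
    · filter_upwards with n
      refine le_trans ?_ (singularValue_nonneg T n)
      exact mul_nonpos_of_nonpos_of_nonneg (not_lt.mp h) (by positivity)
  filter_upwards [hU (C + ε) (by linarith), hlow] with n h1 h2
  have h3 := singularValue_le_of_normLEOffDim (by positivity) h1
  rw [Real.norm_eq_abs, Real.norm_of_nonneg (by positivity), abs_le]
  constructor <;> linarith [add_mul C ε ((n : ℝ) ^ (-γ)), sub_mul C ε ((n : ℝ) ^ (-γ))]

end Asymptotics

/-! ### Polar integration and the shift weights. -/

lemma integral_exp_int_mul_I (l : ℤ) :
    ∫ θ in Set.Ioo (-Real.pi) Real.pi, Complex.exp (l * θ * Complex.I) =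
      if l = 0 then 2 * (Real.pi : ℂ) else 0 := by
  rw [← integral_Ioc_eq_integral_Ioo, ← intervalIntegral.integral_of_le (by linarith [Real.pi_pos])]
  split_ifs with h
  · subst h
    simp
    ring
  · have hc : (l : ℂ) * Complex.I ≠ 0 := by simp [h]
    have : ∀ θ : ℝ, Complex.exp (l * θ * Complex.I) = Complex.exp ((l * Complex.I) * θ) := by
      intro θ; ring_nf
    simp only [this]
    rw [integral_exp_mul_complex hc, div_eq_zero_iff]
    left
    rw [sub_eq_zero, Complex.exp_eq_exp_iff_exists_int]
    exact ⟨l, by push_cast; ring⟩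

/-- Integration in polar coordinates of a function of the form `h(r) e^{ilθ}`. -/
lemma integral_diskMeasure_radial_mul (h : ℝ → ℂ) (l : ℤ) :
    ∫ z, h ‖z‖ * (z / ‖z‖) ^ l ∂diskMeasure =
      if l = 0 then 2 * ∫ r in (0 : ℝ)..1, r * h r else 0 := by
  rw [diskMeasure, integral_smul_measure, ← integral_indicator measurableSet_ball,
    ← Complex.integral_comp_polarCoord_symm, polarCoord_target]
  have h1 : ∀ p ∈ Set.Ioi (0 : ℝ) ×ˢ Set.Ioo (-Real.pi) Real.pi,
      p.1 • (Metric.ball (0 : ℂ) 1).indicator (fun z => h ‖z‖ * (z / ‖z‖) ^ l)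
        (Complex.polarCoord.symm p) =
      (Set.Iio (1 : ℝ)).indicator (fun r => (r : ℂ) * h r) p.1 *
        Complex.exp (l * p.2 * Complex.I) := by
    rintro ⟨r, θ⟩ ⟨hr, -⟩
    have hr0 : (0 : ℝ) < r := hr
    have hnorm : ‖Complex.polarCoord.symm (r, θ)‖ = r := by
      rw [Complex.norm_polarCoord_symm, abs_of_pos hr0]
    have hmem : Complex.polarCoord.symm (r, θ) ∈ Metric.ball (0 : ℂ) 1 ↔ r ∈ Set.Iio (1 : ℝ) := by
      rw [mem_ball_zero_iff, hnorm, Set.mem_Iio]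
    by_cases hr1 : r ∈ Set.Iio (1 : ℝ)
    · rw [Set.indicator_of_mem (hmem.mpr hr1), Set.indicator_of_mem hr1, hnorm]
      have hr' : (r : ℂ) ≠ 0 := by exact_mod_cast hr0.ne'
      have : Complex.polarCoord.symm (r, θ) / r = Complex.exp (θ * Complex.I) := by
        rw [Complex.polarCoord_symm_apply, Complex.exp_mul_I]
        field_simp
        push_cast
        ring
      rw [this, ← Complex.exp_int_mul, Complex.real_smul]
      ring_nf
    · rw [Set.indicator_of_notMem (fun h => hr1 (hmem.mp h)), Set.indicator_of_notMem hr1]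
      simp
  rw [setIntegral_congr_fun (measurableSet_Ioi.prod measurableSet_Ioo) h1,
    Measure.volume_eq_prod, setIntegral_prod_mul ((Set.Iio (1 : ℝ)).indicator fun r => (r : ℂ) * h r)
      (fun θ : ℝ => Complex.exp (l * θ * Complex.I)), integral_exp_int_mul_I,
    setIntegral_indicator measurableSet_Iio, Set.Ioi_inter_Iio,
    ← integral_Ioc_eq_integral_Ioo, ← intervalIntegral.integral_of_le zero_le_one]
  split_ifs with hl
  · have hπ : (Real.pi : ℂ) ≠ 0 := by exact_mod_cast Real.pi_ne_zero
    rw [ENNReal.toReal_inv, ENNReal.toReal_ofReal Real.pi_pos.le, Complex.real_smul]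
    push_cast
    field_simp
  · simp

/-- The integrals `∫ xⁿ (1 - x)^γ` over the unit interval. -/
noncomputable def radialMoment (γ : ℝ) (n : ℕ) : ℝ := ∫ x in (0 : ℝ)..1, x ^ n * (1 - x) ^ γ

/-- The moment is the Beta integral `B(n+1, γ+1)`, so the sequence is Euler's product sequence for
`Γ(γ+1)`. -/
lemma tendsto_rpow_mul_radialMoment {γ : ℝ} (hγ : -1 < γ) :
    Tendsto (fun n : ℕ => (n : ℝ) ^ (γ + 1) * radialMoment γ n) atTop
      (𝓝 (Real.Gamma (γ + 1))) := by
  have hre : 0 < ((γ + 1 : ℝ) : ℂ).re := by rw [Complex.ofReal_re]; linarith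
  have h1 : ∀ n : ℕ, ((n : ℝ) ^ (γ + 1) * radialMoment γ n : ℝ) =
      Complex.GammaSeq ((γ + 1 : ℝ) : ℂ) n := by
    intro n
    rw [Complex.GammaSeq_eq_betaIntegral_of_re_pos hre, ← Complex.betaIntegral_symm,
      Complex.betaIntegral, radialMoment, Complex.ofReal_mul,
      Complex.ofReal_cpow (by positivity), ← intervalIntegral.integral_ofReal]
    congr 1
    refine intervalIntegral.integral_congr fun x hx => ?_
    rw [Set.uIcc_of_le zero_le_one] at hx
    have hx' : (0 : ℝ) ≤ 1 - x := by linarith [hx.2]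
    rw [add_sub_cancel_right, Complex.cpow_natCast, Complex.ofReal_mul, Complex.ofReal_pow,
      Complex.ofReal_cpow hx']
    push_cast
    rw [add_sub_cancel_right]
  have h2 := Complex.GammaSeq_tendsto_Gamma ((γ + 1 : ℝ) : ℂ)
  rw [Complex.Gamma_ofReal] at h2
  have h3 := (Complex.continuous_re.tendsto _).comp h2
  rw [Complex.ofReal_re] at h3
  exact h3.congr fun n => by rw [Function.comp, ← h1, Complex.ofReal_re]

/-- The matrix coefficients of the Toeplitz operator with symbol `(1 - |z|)^γ (z/|z|)^j`. -/
noncomputable def shiftWeight (γ : ℝ) (j : ℤ) (k : ℕ) : ℝ :=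
  -- For `k + j < 0` the second square root takes the default value `0`, so the weight vanishes
  -- whatever `toNat` returns.
  2 * (Real.sqrt (k + 1) * Real.sqrt (k + j + 1)) * radialMoment γ (2 * k + j + 1).toNat

/-- The square roots contribute `k` and the moment `Γ(γ+1)(2k)^{-γ-1}`; with the factor `2` this is
`2^{-γ} Γ(γ+1) k^{-γ}`. The fixed offset `j` disappears in the limit. -/
lemma tendsto_shiftWeight_mul_rpow {γ : ℝ} (hγ : -1 < γ) (j : ℤ) :
    Tendsto (fun k : ℕ => shiftWeight γ j k * (k : ℝ) ^ γ) atTop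
      (𝓝 (2 ^ (-γ) * Real.Gamma (γ + 1))) := by
  have hn : Tendsto (fun k : ℕ => (2 * (k : ℤ) + j + 1).toNat) atTop atTop := by
    refine tendsto_atTop.mpr fun b => ?_
    filter_upwards [eventually_ge_atTop (b + j.natAbs)] with k hk
    omega
  have h1 := (tendsto_rpow_mul_radialMoment hγ).comp hn
  have hinv : Tendsto (fun k : ℕ => ((k : ℝ))⁻¹) atTop (𝓝 0) :=
    tendsto_inv_atTop_zero.comp tendsto_natCast_atTop_atTop
  have h2 : Tendsto (fun k : ℕ => Real.sqrt (1 + (k : ℝ)⁻¹)) atTop (𝓝 (Real.sqrt (1 + 0))) :=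
    (hinv.const_add 1).sqrt
  have h3 : Tendsto (fun k : ℕ => Real.sqrt (1 + ((j : ℝ) + 1) * (k : ℝ)⁻¹)) atTop
      (𝓝 (Real.sqrt (1 + (j + 1) * 0))) := ((hinv.const_mul _).const_add 1).sqrt
  have h4 : Tendsto (fun k : ℕ => (2 + ((j : ℝ) + 1) * (k : ℝ)⁻¹) ^ (-(γ + 1))) atTop
      (𝓝 ((2 + (j + 1) * 0) ^ (-(γ + 1)))) :=
    ((hinv.const_mul _).const_add 2).rpow_const (Or.inl (by simp))
  have h5 := ((((h2.mul h3).const_mul 2).mul h4).mul h1)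
  have hlim : 2 * (Real.sqrt (1 + 0) * Real.sqrt (1 + ((j : ℝ) + 1) * 0)) *
      (2 + ((j : ℝ) + 1) * 0) ^ (-(γ + 1)) * Real.Gamma (γ + 1) =
      2 ^ (-γ) * Real.Gamma (γ + 1) := by
    simp only [add_zero, mul_zero, Real.sqrt_one, mul_one]
    congr 1
    rw [show -(γ + 1) = -γ - 1 by ring, Real.rpow_sub_one two_ne_zero]
    ring
  rw [hlim] at h5
  refine h5.congr' ?_
  filter_upwards [eventually_gt_atTop (j.natAbs + 1)] with k hk
  have hk0 : (0 : ℝ) < k := by exact_mod_cast (by omega : 0 < k)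
  have hkj : (0 : ℝ) < 2 * k + j + 1 := by exact_mod_cast (by omega : (0 : ℤ) < 2 * k + j + 1)
  have hkj' : (0 : ℝ) ≤ k + j + 1 := by exact_mod_cast (by omega : (0 : ℤ) ≤ k + j + 1)
  have hcast : (((2 * (k : ℤ) + j + 1).toNat : ℕ) : ℝ) = 2 * k + j + 1 := by
    have : (((2 * (k : ℤ) + j + 1).toNat : ℕ) : ℤ) = 2 * k + j + 1 := Int.toNat_of_nonneg (by omega)
    exact_mod_cast this
  simp only [Function.comp, hcast, shiftWeight]
  have e1 : 1 + (k : ℝ)⁻¹ = (k + 1) / k := by field_simp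
  have e2 : 1 + ((j : ℝ) + 1) * (k : ℝ)⁻¹ = (k + j + 1) / k := by field_simp; ring
  have e3 : 2 + ((j : ℝ) + 1) * (k : ℝ)⁻¹ = (2 * k + j + 1) / k := by field_simp; ring
  rw [e1, e2, e3, Real.sqrt_div (by positivity), Real.sqrt_div hkj',
    Real.div_rpow hkj.le hk0.le, Real.rpow_neg hkj.le, Real.rpow_neg hk0.le,
    Real.rpow_add_one hk0.ne']
  have hs : Real.sqrt k * Real.sqrt k = k := Real.mul_self_sqrt hk0.le
  have hs0 : 0 < Real.sqrt k := Real.sqrt_pos.mpr hk0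
  have hp : 0 < (2 * (k : ℝ) + j + 1) ^ (γ + 1) := by positivity
  field_simp
  rw [sq, hs]

/-! ### The monomial basis and matrix coefficients. -/

section Basis

/-- The normalised monomial `√(n+1) zⁿ` as an element of the Bergman space. -/
noncomputable def bergmanMonomial (n : ℕ) : bergmanSpace :=
  ((Real.sqrt (n + 1) : ℝ) : ℂ) • ⟨monomialL2 n, Submodule.le_topologicalClosure _
    (Submodule.subset_span ⟨n, rfl⟩)⟩

lemma coeFn_bergmanMonomial (n : ℕ) :
    (bergmanMonomial n : L2Disk) =ᵐ[diskMeasure] fun z => Real.sqrt (n + 1) * z ^ n := by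
  have h1 : (bergmanMonomial n : L2Disk) = ((Real.sqrt (n + 1) : ℝ) : ℂ) • monomialL2 n := rfl
  rw [h1]
  filter_upwards [Lp.coeFn_smul ((Real.sqrt (n + 1) : ℝ) : ℂ) (monomialL2 n),
    (memLp_monomial n).coeFn_toLp] with z hz hz'
  rw [hz, Pi.smul_apply, monomialL2, hz', smul_eq_mul]

lemma ae_diskMeasure_norm_lt_one : ∀ᵐ z ∂diskMeasure, ‖z‖ < 1 := by
  refine Measure.ae_smul_measure ?_ _
  filter_upwards [ae_restrict_mem measurableSet_ball] with z hz
  simpa using hz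

lemma ae_diskMeasure_ne_zero : ∀ᵐ z ∂diskMeasure, z ≠ 0 := by
  refine Measure.ae_smul_measure (ae_restrict_of_ae ?_) _
  exact Measure.ae_ne volume 0

/-- The symbol `(1 - |z|)^γ (z/|z|)^j`. -/
noncomputable def shiftSymbol (γ : ℝ) (j : ℤ) (z : ℂ) : ℂ :=
  (((1 - ‖z‖) ^ γ : ℝ) : ℂ) * (z / ‖z‖) ^ j

/-- Angular integration keeps only `k + j = i`, and the Jacobian `r` raises the radial power to `k +
i + 1 = 2k + j + 1`. The case `γ = 0`, `j = 0` also yields orthonormality of the monomials. -/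
lemma integral_conj_mul_shiftSymbol_mul (γ : ℝ) (j : ℤ) (i k : ℕ) :
    ∫ z, (Real.sqrt (k + 1) * z ^ k) * shiftSymbol γ j z *
      (starRingEnd ℂ) (Real.sqrt (i + 1) * z ^ i) ∂diskMeasure =
      if (k : ℤ) + j = i then (shiftWeight γ j k : ℂ) else 0 := by
  have h1 : ∀ᵐ z ∂diskMeasure, (Real.sqrt (k + 1) * z ^ k) * shiftSymbol γ j z *
      (starRingEnd ℂ) (Real.sqrt (i + 1) * z ^ i) =
      (fun r : ℝ => ((Real.sqrt (k + 1) * Real.sqrt (i + 1) * (r ^ (k + i) * (1 - r) ^ γ) : ℝ) : ℂ))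
        ‖z‖ * (z / ‖z‖) ^ ((k : ℤ) + j - i) := by
    filter_upwards [ae_diskMeasure_ne_zero] with z hz
    have hz' : (‖z‖ : ℂ) ≠ 0 := by exact_mod_cast norm_ne_zero_iff.mpr hz
    set u : ℂ := z / ‖z‖ with hu
    have hu0 : u ≠ 0 := div_ne_zero hz hz'
    have hzu : z = ‖z‖ * u := by rw [hu]; field_simp
    have hcu : (starRingEnd ℂ) u = u⁻¹ := by
      rw [hu, map_div₀, Complex.conj_ofReal, inv_div, div_eq_div_iff hz' hz, mul_comm,
        Complex.mul_conj, Complex.normSq_eq_norm_sq]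
      push_cast
      ring
    rw [shiftSymbol, ← hu, zpow_sub₀ hu0, zpow_add₀ hu0, zpow_natCast, zpow_natCast]
    simp only [map_mul, map_pow, Complex.conj_ofReal]
    conv_lhs => rw [show (starRingEnd ℂ) z = ‖z‖ * u⁻¹ by
      rw [← hcu, ← Complex.conj_ofReal, ← map_mul, ← hzu]]
    conv_lhs => enter [1, 1, 2]; rw [hzu]
    push_cast
    rw [mul_pow, mul_pow, inv_pow, pow_add]
    field_simp
  rw [integral_congr_ae h1, integral_diskMeasure_radial_mul (fun r : ℝ =>
    ((Real.sqrt (k + 1) * Real.sqrt (i + 1) * (r ^ (k + i) * (1 - r) ^ γ) : ℝ) : ℂ))]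
  have hiff : (k : ℤ) + j - i = 0 ↔ (k : ℤ) + j = i := sub_eq_zero
  simp only [hiff]
  split_ifs with h
  · have hn : (2 * (k : ℤ) + j + 1).toNat = k + i + 1 := by omega
    have hi : (k : ℝ) + j + 1 = i + 1 := by
      have : (k : ℝ) + j = i := by exact_mod_cast h
      rw [this]
    rw [shiftWeight, hn, hi, radialMoment]
    have : ∀ r : ℝ, (r : ℂ) * ((Real.sqrt (k + 1) * Real.sqrt (i + 1) *
        (r ^ (k + i) * (1 - r) ^ γ) : ℝ) : ℂ) =
        ((Real.sqrt (k + 1) * Real.sqrt (i + 1) * (r ^ (k + i + 1) * (1 - r) ^ γ) : ℝ) : ℂ) := by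
      intro r; push_cast; ring
    simp only [this]
    rw [intervalIntegral.integral_ofReal, intervalIntegral.integral_const_mul]
    push_cast
    ring
  · rfl

lemma radialMoment_zero (n : ℕ) : radialMoment 0 n = 1 / (n + 1) := by
  simp [radialMoment, integral_pow]

lemma orthonormal_bergmanMonomial : Orthonormal ℂ bergmanMonomial := by
  rw [orthonormal_iff_ite]
  intro i k
  have h := integral_conj_mul_shiftSymbol_mul 0 0 i k
  rw [Submodule.coe_inner, L2.inner_def]
  have h1 : ∀ᵐ z ∂diskMeasure, inner ℂ ((bergmanMonomial i : L2Disk) z)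
      ((bergmanMonomial k : L2Disk) z) = (Real.sqrt (k + 1) * z ^ k) * shiftSymbol 0 0 z *
      (starRingEnd ℂ) (Real.sqrt (i + 1) * z ^ i) := by
    filter_upwards [coeFn_bergmanMonomial i, coeFn_bergmanMonomial k] with z hi hk
    rw [hi, hk]
    simp [shiftSymbol]
  rw [integral_congr_ae h1, h]
  simp only [add_zero, Nat.cast_inj, eq_comm (a := k)]
  split_ifs with hik
  · rw [shiftWeight, show (2 * (k : ℤ) + 0 + 1).toNat = 2 * k + 1 by omega, radialMoment_zero]
    have : Real.sqrt (k + 1) * Real.sqrt (k + (0 : ℤ) + 1) = k + 1 := by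
      rw [Int.cast_zero, add_zero, Real.mul_self_sqrt (by positivity)]
    rw [this]
    push_cast
    have : (2 : ℂ) * k + 1 + 1 ≠ 0 := by exact_mod_cast (by omega : 2 * k + 1 + 1 ≠ 0)
    field_simp
    ring
  · rfl

/-- The orthonormal basis `√(n+1) zⁿ` of the Bergman space. -/
noncomputable def bergmanBasis : HilbertBasis ℕ ℂ bergmanSpace :=
  HilbertBasis.mk orthonormal_bergmanMonomial (by
    rintro ⟨f, hf⟩ -
    have hmem : ∀ n, (monomialL2 n : L2Disk) ∈
        (Submodule.span ℂ (Set.range bergmanMonomial)).map bergmanSpace.subtype := by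
      intro n
      refine ⟨(((Real.sqrt (n + 1) : ℝ) : ℂ))⁻¹ • bergmanMonomial n,
        Submodule.smul_mem _ _ (Submodule.subset_span ⟨n, rfl⟩), ?_⟩
      have h0 : ((Real.sqrt (n + 1) : ℝ) : ℂ) ≠ 0 := by
        exact_mod_cast (Real.sqrt_pos.mpr (by positivity)).ne'
      rw [bergmanMonomial, smul_smul, inv_mul_cancel₀ h0, one_smul]
      rfl
    have hle : Submodule.span ℂ (Set.range monomialL2) ≤
        (Submodule.span ℂ (Set.range bergmanMonomial)).map bergmanSpace.subtype := by
      rw [Submodule.span_le]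
      rintro _ ⟨n, rfl⟩
      exact hmem n
    have hcl : f ∈ closure (Subtype.val '' (Submodule.span ℂ (Set.range bergmanMonomial) :
        Set bergmanSpace)) := closure_mono hle hf
    exact (closure_subtype (x := ⟨f, hf⟩)).mpr hcl)

@[simp]
lemma bergmanBasis_apply (n : ℕ) : bergmanBasis n = bergmanMonomial n := by
  rw [bergmanBasis, HilbertBasis.coe_mk]

end Basis

/-! ### Toeplitz operators with dominated symbol. -/

section FactorizedBound

variable {H H' : Type*} [NormedAddCommGroup H] [InnerProductSpace ℂ H] [CompleteSpace H]
  [NormedAddCommGroup H'] [InnerProductSpace ℂ H']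

/-- Taking `u = T v` gives `‖T v‖² ≤ ‖M (T v)‖ ‖M v‖`. To gain on both factors, `v` and `T v` must
be orthogonal to the first `m` basis vectors; the second demand means `v ⟂ T* e_k`, which doubles
the rank to `2m`. -/
lemma normLEOffDim_of_norm_inner_le (e : HilbertBasis ℕ ℂ H) {T : H →L[ℂ] H} {M : H →L[ℂ] H'}
    (hTM : ∀ u v, ‖inner ℂ u (T v)‖ ≤ ‖M u‖ * ‖M v‖)
    (horth : ∀ i k, i ≠ k → inner ℂ (M (e i)) (M (e k)) = 0) {m : ℕ} {W : ℝ}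
    (hW : ∀ k, m ≤ k → ‖M (e k)‖ ^ 2 ≤ W) : NormLEOffDim T (2 * m) W := by
  classical
  have hW0 : 0 ≤ W := (sq_nonneg _).trans (hW m le_rfl)
  set F₁ := Submodule.span ℂ ((Finset.range m).image e : Set H)
  set F₂ := Submodule.span ℂ
    ((Finset.range m).image fun k => ContinuousLinearMap.adjoint T (e k) : Set H)
  have hF₁ : FiniteDimensional ℂ F₁ := FiniteDimensional.span_finset ℂ _
  have hF₂ : FiniteDimensional ℂ F₂ := FiniteDimensional.span_finset ℂ _
  have h1 : Module.finrank ℂ F₁ ≤ m :=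
    (finrank_span_finset_le_card _).trans (Finset.card_image_le.trans (by simp))
  have h2 : Module.finrank ℂ F₂ ≤ m :=
    (finrank_span_finset_le_card _).trans (Finset.card_image_le.trans (by simp))
  refine ⟨F₁ ⊔ F₂, inferInstance, (Submodule.finrank_add_le_finrank_add_finrank F₁ F₂).trans
    (by omega), fun v hv => ?_⟩
  have hM : ∀ u : H, (∀ k < m, inner ℂ (e k) u = 0) → ‖M u‖ ≤ Real.sqrt W * ‖u‖ := by
    intro u hu
    refine norm_apply_le_of_pairwise_inner_eq_zero e M (Set.Iio m) (Real.sqrt_nonneg W)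
      (fun i _ j _ hij => horth i j hij) (fun i hi => ?_) hu
    exact Real.le_sqrt_of_sq_le (hW i (not_lt.mp hi))
  have hv1 : ∀ k < m, inner ℂ (e k) v = 0 := fun k hk =>
    (Submodule.orthogonal_le le_sup_left hv) _ (Submodule.subset_span (by
      rw [Finset.coe_image]; exact ⟨k, by simpa using hk, rfl⟩))
  have hv2 : ∀ k < m, inner ℂ (e k) (T v) = 0 := fun k hk => by
    rw [← ContinuousLinearMap.adjoint_inner_left]
    exact (Submodule.orthogonal_le le_sup_right hv) _ (Submodule.subset_span (by
      rw [Finset.coe_image]; exact ⟨k, by simpa using hk, rfl⟩))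
  have h3 := hTM (T v) v
  rw [norm_inner_symm, inner_self_eq_norm_sq_to_K, norm_pow] at h3
  have h4 : ‖T v‖ ^ 2 ≤ W * ‖v‖ * ‖T v‖ := by
    calc ‖T v‖ ^ 2 ≤ ‖M (T v)‖ * ‖M v‖ := by simpa using h3
      _ ≤ (Real.sqrt W * ‖T v‖) * (Real.sqrt W * ‖v‖) :=
          mul_le_mul (hM _ hv2) (hM _ hv1) (norm_nonneg _) (by positivity)
      _ = W * ‖v‖ * ‖T v‖ := by
          rw [mul_mul_mul_comm, Real.mul_self_sqrt hW0]; ring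
  rcases (norm_nonneg (T v)).eq_or_lt with h | h
  · rw [← h]; positivity
  · rw [sq] at h4
    exact le_of_mul_le_mul_right h4 h

end FactorizedBound

lemma HilbertBasis.eq_smul_of_inner_eq {H : Type*} [NormedAddCommGroup H] [InnerProductSpace ℂ H]
    (e : HilbertBasis ℕ ℂ H) {x : H} {c : ℂ} {i : ℕ}
    (h : ∀ i', inner ℂ (e i') x = if i = i' then c else 0) : x = c • e i := by
  refine e.repr.injective ?_
  ext i'
  rw [e.repr_apply_apply, e.repr_apply_apply, h, inner_smul_right,
    orthonormal_iff_ite.mp e.orthonormal]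
  simp only [mul_ite, mul_one, mul_zero, eq_comm]

section Toeplitz

lemma toeplitz_sub (f g : Lp ℂ ∞ diskMeasure) : toeplitz (f - g) = toeplitz f - toeplitz g := by
  ext v : 1
  simp [toeplitz, mulOperator]

lemma toeplitz_smul_add_smul (a b : ℂ) (f g : Lp ℂ ∞ diskMeasure) :
    toeplitz (a • f + b • g) = a • toeplitz f + b • toeplitz g := by
  ext v : 1
  simp [toeplitz, mulOperator]

lemma toeplitz_sum_smul {ι : Type*} (J : Finset ι) (a : ι → ℂ) (f : ι → Lp ℂ ∞ diskMeasure) :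
    toeplitz (∑ j ∈ J, a j • f j) = ∑ j ∈ J, a j • toeplitz (f j) := by
  ext v : 1
  simp [toeplitz, mulOperator]

lemma inner_toeplitz (f : Lp ℂ ∞ diskMeasure) (u v : bergmanSpace) :
    inner ℂ u (toeplitz f v) = inner ℂ (u : L2Disk) (mulOperator f (v : L2Disk)) := by
  rw [toeplitz]
  exact Submodule.inner_orthogonalProjectionOnto_eq_of_mem_left u _

lemma inner_toeplitz_eq_integral (f : Lp ℂ ∞ diskMeasure) (u v : bergmanSpace) :
    inner ℂ u (toeplitz f v) = ∫ z, (v : L2Disk) z * f z *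
      (starRingEnd ℂ) ((u : L2Disk) z) ∂diskMeasure := by
  rw [inner_toeplitz, L2.inner_def]
  refine integral_congr_ae ?_
  filter_upwards [coeFn_mulOperator f v] with z hz
  rw [hz, RCLike.inner_apply]
  ring

lemma inner_mulOperator_mulOperator (s f : Lp ℂ ∞ diskMeasure)
    (h : ∀ᵐ z ∂diskMeasure, f z = (starRingEnd ℂ) (s z) * s z) (u v : bergmanSpace) :
    inner ℂ (mulOperator s (u : L2Disk)) (mulOperator s (v : L2Disk)) =
      inner ℂ u (toeplitz f v) := by
  rw [inner_toeplitz_eq_integral, L2.inner_def]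
  refine integral_congr_ae ?_
  filter_upwards [coeFn_mulOperator s u, coeFn_mulOperator s v, h] with z hu hv hf
  rw [hu, hv, hf, RCLike.inner_apply, map_mul]
  ring

lemma norm_eq_integral_rpow (f : L2Disk) :
    ‖f‖ = (∫ z, ‖f z‖ ^ (2 : ℝ) ∂diskMeasure) ^ (1 / (2 : ℝ)) := by
  have h := L2.inner_def (𝕜 := ℂ) f f
  rw [inner_self_eq_norm_sq_to_K] at h
  have h1 : ∀ z, inner ℂ (f z) (f z) = ((‖f z‖ ^ (2 : ℝ) : ℝ) : ℂ) := fun z => by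
    rw [inner_self_eq_norm_sq_to_K, Real.rpow_two]
    push_cast
    rfl
  simp only [h1] at h
  rw [integral_complex_ofReal] at h
  have h2 : ‖f‖ ^ 2 = ∫ z, ‖f z‖ ^ (2 : ℝ) ∂diskMeasure :=
    Complex.ofReal_injective (by rw [← h]; push_cast; rfl)
  rw [← h2, ← Real.sqrt_eq_rpow, Real.sqrt_sq (norm_nonneg _)]

/-- Cauchy–Schwarz after splitting `|f|` symmetrically; it serves complex symbols, to which no
operator ordering applies. -/
lemma norm_inner_toeplitz_le (s f : Lp ℂ ∞ diskMeasure)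
    (h : ∀ᵐ z ∂diskMeasure, ‖f z‖ ≤ ‖s z‖ ^ 2) (u v : bergmanSpace) :
    ‖inner ℂ u (toeplitz f v)‖ ≤
      ‖mulOperator s (u : L2Disk)‖ * ‖mulOperator s (v : L2Disk)‖ := by
  have hmem : ∀ g : L2Disk, MemLp g (ENNReal.ofReal 2) diskMeasure := fun g => by
    simpa using Lp.memLp g
  rw [inner_toeplitz_eq_integral, norm_eq_integral_rpow, norm_eq_integral_rpow]
  refine le_trans ?_ (integral_mul_norm_le_Lp_mul_Lq Real.HolderConjugate.two_two
    (hmem _) (hmem _))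
  refine norm_integral_le_of_norm_le ?_ ?_
  · exact MemLp.integrable_mul (p := 2) (q := 2) (Lp.memLp _).norm (Lp.memLp _).norm
  · filter_upwards [coeFn_mulOperator s u, coeFn_mulOperator s v, h] with z hu hv hf
    rw [hu, hv, norm_mul, norm_mul, norm_mul, norm_mul, RCLike.norm_conj]
    calc ‖(v : L2Disk) z‖ * ‖f z‖ * ‖(u : L2Disk) z‖
        ≤ ‖(v : L2Disk) z‖ * ‖s z‖ ^ 2 * ‖(u : L2Disk) z‖ := by gcongr
      _ = _ := by ring

lemma measurable_shiftSymbol (γ : ℝ) (j : ℤ) : Measurable (shiftSymbol γ j) := by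
  unfold shiftSymbol
  refine Measurable.mul (by fun_prop) ?_
  have : Measurable fun z : ℂ => z / ‖z‖ := by fun_prop
  cases j with
  | ofNat n => simpa using this.pow_const n
  | negSucc n => simp only [zpow_negSucc]; exact (this.pow_const (n + 1)).inv

lemma norm_shiftSymbol_le {γ : ℝ} (hγ : 0 ≤ γ) (j : ℤ) {z : ℂ} (hz : z ≠ 0) (hz1 : ‖z‖ < 1) :
    ‖shiftSymbol γ j z‖ ≤ 1 := by
  have h1 : ‖z / (‖z‖ : ℂ)‖ = 1 := by
    rw [norm_div, Complex.norm_real, norm_norm, div_self (norm_ne_zero_iff.mpr hz)]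
  rw [shiftSymbol, norm_mul, norm_zpow, h1, one_zpow, mul_one, Complex.norm_real,
    Real.norm_of_nonneg (Real.rpow_nonneg (by linarith) _)]
  exact Real.rpow_le_one (by linarith) (by linarith [norm_nonneg z]) hγ

lemma memLp_shiftSymbol {γ : ℝ} (hγ : 0 ≤ γ) (j : ℤ) :
    MemLp (shiftSymbol γ j) ∞ diskMeasure := by
  refine memLp_top_of_bound (measurable_shiftSymbol γ j).aestronglyMeasurable 1 ?_
  filter_upwards [ae_diskMeasure_norm_lt_one, ae_diskMeasure_ne_zero] with z h1 h0
  exact norm_shiftSymbol_le hγ j h0 h1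

lemma inner_bergmanBasis_toeplitz_shiftSymbol {γ : ℝ} (hγ : 0 ≤ γ) (j : ℤ) (k i : ℕ) :
    inner ℂ (bergmanBasis i) (toeplitz (memLp_shiftSymbol hγ j).toLp (bergmanBasis k)) =
      if (k : ℤ) + j = i then (shiftWeight γ j k : ℂ) else 0 := by
  rw [inner_toeplitz_eq_integral, ← integral_conj_mul_shiftSymbol_mul]
  refine integral_congr_ae ?_
  filter_upwards [coeFn_bergmanMonomial i, coeFn_bergmanMonomial k,
    (memLp_shiftSymbol hγ j).coeFn_toLp] with z hi hk hs
  rw [bergmanBasis_apply, bergmanBasis_apply, hi, hk, hs]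

/-- The Toeplitz operator with symbol `(1 - |z|)^γ (z/|z|)^j` is a weighted shift. -/
lemma toeplitz_shiftSymbol_bergmanBasis {γ : ℝ} (hγ : 0 ≤ γ) (j : ℤ) (k i : ℕ)
    (hki : (k : ℤ) + j = i) :
    toeplitz (memLp_shiftSymbol hγ j).toLp (bergmanBasis k) =
      (shiftWeight γ j k : ℂ) • bergmanBasis i := by
  refine HilbertBasis.eq_smul_of_inner_eq bergmanBasis fun i' => ?_
  rw [inner_bergmanBasis_toeplitz_shiftSymbol hγ, hki]
  simp only [Nat.cast_inj]

/-- Let `s` be the square root of the radial majorant. Multiplication by `s` sends the basis to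
orthogonal vectors whose squared norms are the diagonal entries of the Toeplitz operator of the
majorant. -/
lemma normLEOffDim_toeplitz_of_le {γ : ℝ} (hγ : 0 ≤ γ) {E C : ℝ} (hE : 0 ≤ E) (hC : 0 ≤ C)
    (f : Lp ℂ ∞ diskMeasure)
    (hf : ∀ᵐ z ∂diskMeasure, ‖f z‖ ≤ E * (1 - ‖z‖) ^ γ + C * (1 - ‖z‖) ^ (γ + 1)) {m : ℕ} {W : ℝ}
    (hW : ∀ k, m ≤ k → E * shiftWeight γ 0 k + C * shiftWeight (γ + 1) 0 k ≤ W) :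
    NormLEOffDim (toeplitz f) (2 * m) W := by
  set w : ℂ → ℝ := fun z => E * (1 - ‖z‖) ^ γ + C * (1 - ‖z‖) ^ (γ + 1) with hw
  have hw0 : ∀ z : ℂ, ‖z‖ < 1 → 0 ≤ w z := fun z hz => by
    have : 0 ≤ 1 - ‖z‖ := by linarith
    positivity
  have hs : MemLp (fun z => ((Real.sqrt (w z) : ℝ) : ℂ)) ∞ diskMeasure := by
    refine memLp_top_of_bound (by fun_prop) (Real.sqrt (E + C)) ?_
    filter_upwards [ae_diskMeasure_norm_lt_one] with z hz
    rw [Complex.norm_real, Real.norm_of_nonneg (Real.sqrt_nonneg _)]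
    have h1 : ∀ β : ℝ, 0 ≤ β → (1 - ‖z‖) ^ β ≤ 1 := fun β hβ =>
      Real.rpow_le_one (by linarith) (by linarith [norm_nonneg z]) hβ
    refine Real.sqrt_le_sqrt (add_le_add ?_ ?_)
    · exact mul_le_of_le_one_right hE (h1 _ hγ)
    · exact mul_le_of_le_one_right hC (h1 _ (by linarith))
  have hγ1 : 0 ≤ γ + 1 := by linarith
  set s : Lp ℂ ∞ diskMeasure := hs.toLp with hs_def
  set g : Lp ℂ ∞ diskMeasure := (E : ℂ) • (memLp_shiftSymbol hγ 0).toLp +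
    (C : ℂ) • (memLp_shiftSymbol hγ1 0).toLp with hg
  have hgs : ∀ᵐ z ∂diskMeasure, g z = (starRingEnd ℂ) (s z) * s z := by
    filter_upwards [hs.coeFn_toLp, Lp.coeFn_add ((E : ℂ) • (memLp_shiftSymbol hγ 0).toLp)
      ((C : ℂ) • (memLp_shiftSymbol hγ1 0).toLp), Lp.coeFn_smul (E : ℂ)
      (memLp_shiftSymbol hγ 0).toLp, Lp.coeFn_smul (C : ℂ) (memLp_shiftSymbol hγ1 0).toLp,
      (memLp_shiftSymbol hγ 0).coeFn_toLp, (memLp_shiftSymbol hγ1 0).coeFn_toLp,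
      ae_diskMeasure_norm_lt_one] with z h1 h2 h3 h4 h5 h6 h7
    rw [hg, h2, Pi.add_apply, h3, h4, Pi.smul_apply, Pi.smul_apply, h5, h6, hs_def, h1,
      Complex.conj_ofReal, ← Complex.ofReal_mul, Real.mul_self_sqrt (hw0 z h7), hw]
    simp [shiftSymbol]
  have hinner : ∀ i k : ℕ, inner ℂ (mulOperator s (bergmanBasis i : L2Disk))
      (mulOperator s (bergmanBasis k : L2Disk)) =
      if k = i then ((E * shiftWeight γ 0 k + C * shiftWeight (γ + 1) 0 k : ℝ) : ℂ) else 0 := by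
    intro i k
    rw [inner_mulOperator_mulOperator _ g hgs, hg, toeplitz_smul_add_smul, add_apply, smul_apply, smul_apply,
      inner_add_right, inner_smul_right, inner_smul_right,
      inner_bergmanBasis_toeplitz_shiftSymbol hγ, inner_bergmanBasis_toeplitz_shiftSymbol hγ1]
    simp only [add_zero, Nat.cast_inj]
    split_ifs
    · push_cast; rfl
    · simp
  refine normLEOffDim_of_norm_inner_le bergmanBasis
    (M := mulOperator s ∘L bergmanSpace.subtypeL) (fun u v => ?_) (fun i k hik => ?_)
    (fun k hk => ?_)
  · refine norm_inner_toeplitz_le s f ?_ u v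
    filter_upwards [hf, hs.coeFn_toLp, ae_diskMeasure_norm_lt_one] with z h1 h2 h3
    rw [hs_def, h2, Complex.norm_real, Real.norm_of_nonneg (Real.sqrt_nonneg _), Real.sq_sqrt (hw0 z h3)]
    exact h1
  · exact (hinner i k).trans (if_neg fun h => hik h.symm)
  · have h1 := hinner k k
    rw [if_pos rfl, inner_self_eq_norm_sq_to_K] at h1
    have h2 : ‖mulOperator s (bergmanBasis k : L2Disk)‖ ^ 2 =
        E * shiftWeight γ 0 k + C * shiftWeight (γ + 1) 0 k :=
      Complex.ofReal_injective (by rw [← h1]; push_cast; rfl)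
    exact h2.le.trans (hW k hk)

/-- If the symbol is `O((1 - |z|)^γ)` with constant `E` up to a faster decaying term, the Toeplitz
operator has small singular values. -/
lemma eventually_normLEOffDim_toeplitz {γ : ℝ} (hγ : 0 < γ) {E C : ℝ} (hE : 0 < E) (hC : 0 ≤ C)
    (f : Lp ℂ ∞ diskMeasure)
    (hf : ∀ᵐ z ∂diskMeasure, ‖f z‖ ≤ E * (1 - ‖z‖) ^ γ + C * (1 - ‖z‖) ^ (γ + 1)) {δ η : ℝ}
    (hδ : 0 < δ)
    (hη : 2 * E * (2 ^ (-γ) * Real.Gamma (γ + 1)) * (δ / 4) ^ (-γ) ≤ η) :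
    ∀ᶠ n : ℕ in atTop, ∃ r : ℕ, (r : ℝ) ≤ δ * n ∧
      NormLEOffDim (toeplitz f) r (η * (n : ℝ) ^ (-γ)) := by
  set κ := 2 ^ (-γ) * Real.Gamma (γ + 1) with hκ
  have hκ0 : 0 < κ := mul_pos (by positivity) (Real.Gamma_pos_of_pos (by linarith))
  have h1 := tendsto_shiftWeight_mul_rpow (γ := γ) (by linarith) 0
  have h2 := tendsto_shiftWeight_mul_rpow (γ := γ + 1) (by linarith) 0
  have hinv : Tendsto (fun k : ℕ => ((k : ℝ))⁻¹) atTop (𝓝 0) :=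
    tendsto_inv_atTop_zero.comp tendsto_natCast_atTop_atTop
  have h3 := (h1.const_mul E).add ((h2.mul hinv).const_mul C)
  rw [mul_zero, mul_zero, add_zero, ← hκ] at h3
  have h4 : ∀ᶠ k : ℕ in atTop, E * shiftWeight γ 0 k + C * shiftWeight (γ + 1) 0 k ≤
      2 * E * κ * (k : ℝ) ^ (-γ) := by
    -- The limit is `E κ`; doubling it absorbs the `C` term, which is of order `k^{-γ-1}`.
    filter_upwards [h3.eventually (ge_mem_nhds (show E * κ < 2 * E * κ by nlinarith [mul_pos hE hκ0])),
      eventually_gt_atTop 0] with k hk hk0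
    have hk0' : (0 : ℝ) < k := by exact_mod_cast hk0
    rw [Real.rpow_add_one hk0'.ne'] at hk
    have h5 : E * (shiftWeight γ 0 k * (k : ℝ) ^ γ) +
        C * (shiftWeight (γ + 1) 0 k * ((k : ℝ) ^ γ * k) * (k : ℝ)⁻¹) =
        (E * shiftWeight γ 0 k + C * shiftWeight (γ + 1) 0 k) * (k : ℝ) ^ γ := by
      field_simp
    rw [h5] at hk
    rw [Real.rpow_neg hk0'.le, ← div_eq_mul_inv, le_div_iff₀ (by positivity)]
    exact hk
  obtain ⟨k₀, hk₀⟩ := eventually_atTop.mp h4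
  have hlim : Tendsto (fun n : ℕ => δ / 4 * (n : ℝ)) atTop atTop :=
    tendsto_natCast_atTop_atTop.const_mul_atTop (by positivity)
  filter_upwards [hlim.eventually_ge_atTop ((k₀ : ℝ) + 1), eventually_gt_atTop 0] with n hn hn0
  have hn0' : (0 : ℝ) < n := by exact_mod_cast hn0
  have hfl : (⌊δ / 2 * n⌋₊ : ℝ) ≤ δ / 2 * n := Nat.floor_le (by positivity)
  have hfl' : δ / 2 * n < ⌊δ / 2 * n⌋₊ + 1 := Nat.lt_floor_add_one _
  have hk₀0 : (0 : ℝ) ≤ k₀ := by positivity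
  -- The rank `2m` stays below `δn`, while `m ≥ δn/4` explains the factor `(δ/4)^{-γ}` in `hη`.
  set m := ⌊δ / 2 * n⌋₊
  have hm : δ / 4 * n ≤ m := by linarith
  have hm0 : (0 : ℝ) < δ / 4 * n := by positivity
  have hmk : k₀ ≤ m := by
    have : (k₀ : ℝ) ≤ m := by linarith
    exact_mod_cast this
  refine ⟨2 * m, by push_cast; linarith, normLEOffDim_toeplitz_of_le hγ.le hE.le hC f hf ?_⟩
  intro k hk
  have hmkR : (m : ℝ) ≤ k := by exact_mod_cast hk
  calc E * shiftWeight γ 0 k + C * shiftWeight (γ + 1) 0 k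
      ≤ 2 * E * κ * (k : ℝ) ^ (-γ) := hk₀ k (hmk.trans hk)
    _ ≤ 2 * E * κ * (δ / 4 * n) ^ (-γ) := by
        refine mul_le_mul_of_nonneg_left ?_ (by positivity)
        exact Real.rpow_le_rpow_of_nonpos hm0 (hm.trans hmkR) (by linarith)
    _ = 2 * E * κ * (δ / 4) ^ (-γ) * (n : ℝ) ^ (-γ) := by
        rw [Real.mul_rpow (by positivity) hn0'.le]; ring
    _ ≤ _ := by gcongr

end Toeplitz

/-! ### Approximation of the symbol, and the theorem. -/

/-- Trigonometric polynomials are uniformly dense in the continuous functions on the circle. -/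
lemma exists_trigPoly_norm_sub_le {g : Circle → ℂ} (hg : Continuous g) {ε : ℝ} (hε : 0 < ε) :
    ∃ (J : Finset ℤ) (a : ℤ → ℂ), ∀ ζ, ‖g ζ - trigPoly J a ζ‖ ≤ ε := by
  have : Fact (0 < 2 * Real.pi) := ⟨Real.two_pi_pos⟩
  let G : C(AddCircle (2 * Real.pi), ℂ) :=
    ⟨fun x => g (AddCircle.toCircle x), hg.comp AddCircle.continuous_toCircle⟩
  have hG : G ∈ (Submodule.span ℂ (Set.range (@fourier (2 * Real.pi)))).topologicalClosure := by
    rw [span_fourier_closure_eq_top]; trivial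
  obtain ⟨q, hq, hGq⟩ := Metric.mem_closure_iff.mp hG ε hε
  obtain ⟨c, rfl⟩ := Finsupp.mem_span_range_iff_exists_finsupp.mp hq
  refine ⟨c.support, c, fun ζ => ?_⟩
  set x : AddCircle (2 * Real.pi) := ((Complex.arg ζ : ℝ) : AddCircle (2 * Real.pi))
  have hx : AddCircle.toCircle x = ζ := by
    rw [AddCircle.toCircle_apply_mk, div_self Real.two_pi_pos.ne', one_mul, Circle.exp_arg]
  have h1 := (ContinuousMap.dist_apply_le_dist (f := G)
    (g := c.sum fun i a => a • fourier i) x).trans hGq.le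
  rw [dist_eq_norm] at h1
  have h2 : (c.sum fun i a => a • (fourier i : C(AddCircle (2 * Real.pi), ℂ))) x =
      trigPoly c.support c ζ := by
    simp only [Finsupp.sum, trigPoly, ContinuousMap.coe_sum, Finset.sum_apply,
      ContinuousMap.coe_smul, Pi.smul_apply, fourier_apply, AddCircle.toCircle_zsmul, hx,
      smul_eq_mul, Circle.coe_zpow]
  rw [h2] at h1
  simpa [G, hx] using h1

lemma tendsto_circleMean_norm_rpow {β : ℝ} (hβ : 0 ≤ β) {g : Circle → ℂ} (hg : Continuous g)
    {p : ℕ → Circle → ℂ} (hp : ∀ n, Continuous (p n))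
    (hpg : ∀ n ζ, ‖g ζ - p n ζ‖ ≤ 1 / ((n : ℝ) + 1)) :
    Tendsto (fun n => circleMean fun ζ => ‖p n ζ‖ ^ β) atTop
      (𝓝 (circleMean fun ζ => ‖g ζ‖ ^ β)) := by
  unfold circleMean
  refine Tendsto.const_mul _ ?_
  have hn1 : ∀ n : ℕ, 1 / ((n : ℝ) + 1) ≤ 1 := fun n => by
    rw [div_le_one (by positivity)]
    linarith [n.cast_nonneg (α := ℝ)]
  refine intervalIntegral.tendsto_integral_filter_of_dominated_convergence
    (fun θ => (‖g (Circle.exp θ)‖ + 1) ^ β) (Eventually.of_forall fun n => ?_)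
    (Eventually.of_forall fun n => Eventually.of_forall fun θ _ => ?_) ?_
    (Eventually.of_forall fun θ _ => ?_)
  · have hc := hp n
    exact Continuous.aestronglyMeasurable
      ((hc.comp Circle.exp.continuous).norm.rpow_const fun _ => Or.inr hβ)
  · rw [Real.norm_of_nonneg (by positivity)]
    refine Real.rpow_le_rpow (norm_nonneg _) ?_ hβ
    have h1 := norm_sub_norm_le (p n (Circle.exp θ)) (g (Circle.exp θ))
    rw [norm_sub_rev] at h1
    linarith [hpg n (Circle.exp θ), hn1 n]
  · exact Continuous.intervalIntegrable
      (((hg.comp Circle.exp.continuous).norm.add continuous_const).rpow_const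
        fun _ => Or.inr hβ) _ _
  · refine Tendsto.rpow_const ?_ (Or.inr hβ)
    refine Tendsto.norm ?_
    rw [tendsto_iff_norm_sub_tendsto_zero]
    refine squeeze_zero (fun _ => norm_nonneg _) (fun n => ?_)
      tendsto_one_div_add_atTop_nhds_zero_nat
    rw [norm_sub_rev]
    exact hpg n _

/-- A symbol uniformly close to `(1 - r)^γ p(e^{iθ})` near the boundary is dominated by
`E (1 - r)^γ` up to a faster decaying term. -/
lemma exists_norm_sub_shiftSymbol_le {φ : ℂ → ℂ} (hφ : MemLp φ ∞ diskMeasure) {γ : ℝ} (hγ : 0 < γ)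
    {g : Circle → ℂ}
    (hlim : TendstoUniformly
      (fun (r : ℝ) (ζ : Circle) => (((1 - r) ^ (-γ) : ℝ) : ℂ) * φ ((r : ℂ) * (ζ : ℂ)))
      g (𝓝[<] (1 : ℝ))) {J : Finset ℤ} {a : ℤ → ℂ} {ε : ℝ} (hε : 0 < ε)
    (hp : ∀ ζ, ‖g ζ - trigPoly J a ζ‖ ≤ ε) :
    ∃ C : ℝ, 0 ≤ C ∧ ∀ᵐ z ∂diskMeasure,
      ‖(hφ.toLp - ∑ j ∈ J, a j • (memLp_shiftSymbol hγ.le j).toLp : Lp ℂ ∞ diskMeasure) z‖ ≤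
        2 * ε * (1 - ‖z‖) ^ γ + C * (1 - ‖z‖) ^ (γ + 1) := by
  obtain ⟨r₀, hr₀, hr⟩ : ∃ r₀ < (1 : ℝ), ∀ r, r₀ < r → r < 1 → ∀ ζ : Circle,
      ‖g ζ - (((1 - r) ^ (-γ) : ℝ) : ℂ) * φ ((r : ℂ) * (ζ : ℂ))‖ < ε := by
    have h1 := Metric.tendstoUniformly_iff.mp hlim ε hε
    obtain ⟨r₀, hr₀, h2⟩ := (mem_nhdsLT_iff_exists_Ioo_subset' zero_lt_one).mp h1
    refine ⟨r₀, hr₀, fun r h3 h4 ζ => ?_⟩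
    have := h2 ⟨h3, h4⟩ ζ
    rwa [dist_eq_norm] at this
  set K := (eLpNormEssSup φ diskMeasure).toReal with hK
  have hKφ : ∀ᵐ z ∂diskMeasure, ‖φ z‖ ≤ K := by
    have hfin : eLpNormEssSup φ diskMeasure ≠ ∞ := by
      rw [← eLpNorm_exponent_top]; exact hφ.2.ne
    filter_upwards [ae_le_eLpNormEssSup (f := φ) (μ := diskMeasure)] with z hz
    have := ENNReal.toReal_mono hfin hz
    simpa using this
  set s := ∑ j ∈ J, ‖a j‖ with hs
  have hs0 : 0 ≤ s := Finset.sum_nonneg fun _ _ => norm_nonneg _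
  have hK0 : 0 ≤ K := ENNReal.toReal_nonneg
  have h1r₀ : 0 < 1 - r₀ := by linarith
  -- On `|z| ≤ r₀` the difference is at most `K + s` and `(1-|z|)/(1-r₀) ≥ 1`, so this term alone
  -- dominates there; its faster decay makes the size of the constant irrelevant.
  refine ⟨(K + s) / (1 - r₀) ^ (γ + 1), by positivity, ?_⟩
  have hsum : ∀ᵐ z ∂diskMeasure,
      (∑ j ∈ J, a j • (memLp_shiftSymbol hγ.le j).toLp : Lp ℂ ∞ diskMeasure) z =
      ∑ j ∈ J, a j * shiftSymbol γ j z := by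
    have h2 : ∀ᵐ z ∂diskMeasure, ∀ j ∈ J,
        (a j • (memLp_shiftSymbol hγ.le j).toLp : Lp ℂ ∞ diskMeasure) z =
          a j * shiftSymbol γ j z := by
      rw [Filter.eventually_all_finset]
      intro j _
      filter_upwards [Lp.coeFn_smul (a j) (memLp_shiftSymbol hγ.le j).toLp,
        (memLp_shiftSymbol hγ.le j).coeFn_toLp] with z h3 h4
      rw [h3, Pi.smul_apply, h4, smul_eq_mul]
    filter_upwards [h2, Lp.coeFn_finsetSum J
      fun j => a j • (memLp_shiftSymbol hγ.le j).toLp] with z h3 h4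
    rw [h4, Finset.sum_apply]
    exact Finset.sum_congr rfl h3
  filter_upwards [hsum, hKφ, ae_diskMeasure_norm_lt_one, ae_diskMeasure_ne_zero, hφ.coeFn_toLp,
    Lp.coeFn_sub hφ.toLp (∑ j ∈ J, a j • (memLp_shiftSymbol hγ.le j).toLp)]
    with z h1 h2 h3 h4 h5 h6
  rw [h6, Pi.sub_apply, h1, h5]
  have h1z : 0 < 1 - ‖z‖ := by linarith
  by_cases hz : r₀ < ‖z‖
  · have hz0 : (‖z‖ : ℂ) ≠ 0 := by exact_mod_cast norm_ne_zero_iff.mpr h4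
    have hnorm : ‖z / (‖z‖ : ℂ)‖ = 1 := by
      rw [norm_div, Complex.norm_real, norm_norm, div_self (norm_ne_zero_iff.mpr h4)]
    set ζ : Circle := ⟨z / ‖z‖, mem_sphere_zero_iff_norm.mpr hnorm⟩ with hζ
    have hζc : (ζ : ℂ) = z / ‖z‖ := rfl
    have h7 := hr ‖z‖ hz h3 ζ
    have h8 : (‖z‖ : ℂ) * (ζ : ℂ) = z := by rw [hζc]; field_simp
    rw [h8] at h7
    have h9 : ∑ j ∈ J, a j * shiftSymbol γ j z = (((1 - ‖z‖) ^ γ : ℝ) : ℂ) * trigPoly J a ζ := by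
      rw [trigPoly, Finset.mul_sum]
      refine Finset.sum_congr rfl fun j _ => ?_
      rw [shiftSymbol, hζc]
      ring
    have h10 : φ z - ∑ j ∈ J, a j * shiftSymbol γ j z = (((1 - ‖z‖) ^ γ : ℝ) : ℂ) *
        ((g ζ - trigPoly J a ζ) - (g ζ - (((1 - ‖z‖) ^ (-γ) : ℝ) : ℂ) * φ z)) := by
      have h11 : (((1 - ‖z‖) ^ γ : ℝ) : ℂ) * (((1 - ‖z‖) ^ (-γ) : ℝ) : ℂ) = 1 := by
        rw [← Complex.ofReal_mul, ← Real.rpow_add h1z, add_neg_cancel, Real.rpow_zero,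
          Complex.ofReal_one]
      rw [h9]
      linear_combination (-φ z) * h11
    -- One `ε` comes from the polynomial approximation, the other from the uniform radial limit.
    have h12 : ‖(g ζ - trigPoly J a ζ) - (g ζ - (((1 - ‖z‖) ^ (-γ) : ℝ) : ℂ) * φ z)‖ ≤ 2 * ε := by
      refine (norm_sub_le _ _).trans ?_
      linarith [hp ζ]
    rw [h10, norm_mul, Complex.norm_real, Real.norm_of_nonneg (by positivity)]
    have h13 : 0 ≤ (K + s) / (1 - r₀) ^ (γ + 1) * (1 - ‖z‖) ^ (γ + 1) := by positivity
    calc (1 - ‖z‖) ^ γ * _ ≤ (1 - ‖z‖) ^ γ * (2 * ε) := by gcongr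
      _ ≤ _ := by linarith
  · have hle : 1 - r₀ ≤ 1 - ‖z‖ := by linarith
    have h7 : ‖φ z - ∑ j ∈ J, a j * shiftSymbol γ j z‖ ≤ K + s := by
      refine (norm_sub_le _ _).trans (add_le_add h2 ((norm_sum_le _ _).trans ?_))
      refine Finset.sum_le_sum fun j _ => ?_
      rw [norm_mul]
      exact mul_le_of_le_one_right (norm_nonneg _) (norm_shiftSymbol_le hγ.le j h4 h3)
    have h8 : K + s ≤ (K + s) / (1 - r₀) ^ (γ + 1) * (1 - ‖z‖) ^ (γ + 1) := by
      rw [div_mul_eq_mul_div, le_div_iff₀ (by positivity)]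
      gcongr
    have h9 : 0 ≤ 2 * ε * (1 - ‖z‖) ^ γ := by positivity
    linarith

lemma toeplitzCoeff_eq (γ : ℝ) (g : Circle → ℂ) :
    toeplitzCoeff γ g =
      2 ^ (-γ) * Real.Gamma (γ + 1) * (circleMean fun ζ => ‖g ζ‖ ^ (1 / γ)) ^ γ := rfl

/-- The Toeplitz operator is approximated by those with symbols `(1 - |z|)^γ p(z/|z|)`, where `p` is
a trigonometric polynomial whose coefficient is close to that of the limit function. -/
lemma exists_trigPoly_approx_toeplitz {φ : ℂ → ℂ} (hφ : MemLp φ ∞ diskMeasure) {γ : ℝ}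
    (hγ : 0 < γ) {g : Circle → ℂ} (hg : Continuous g)
    (hlim : TendstoUniformly
      (fun (r : ℝ) (ζ : Circle) => (((1 - r) ^ (-γ) : ℝ) : ℂ) * φ ((r : ℂ) * (ζ : ℂ)))
      g (𝓝[<] (1 : ℝ))) {U : Set ℝ} (hU : U ∈ 𝓝 (toeplitzCoeff γ g)) {δ η : ℝ} (hδ : 0 < δ)
    (hη : 0 < η) :
    ∃ (J : Finset ℤ) (a : ℤ → ℂ), toeplitzCoeff γ (trigPoly J a) ∈ U ∧
      ∀ᶠ n : ℕ in atTop, ∃ r : ℕ, (r : ℝ) ≤ δ * n ∧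
        NormLEOffDim (toeplitz hφ.toLp - ∑ j ∈ J, a j • toeplitz (memLp_shiftSymbol hγ.le j).toLp) r
          (η * (n : ℝ) ^ (-γ)) := by
  choose J a hJa using fun n : ℕ => exists_trigPoly_norm_sub_le hg (ε := 1 / ((n : ℝ) + 1))
    (by positivity)
  have h1 : Tendsto (fun n => toeplitzCoeff γ (trigPoly (J n) (a n))) atTop
      (𝓝 (toeplitzCoeff γ g)) := by
    simp only [toeplitzCoeff_eq]
    exact ((tendsto_circleMean_norm_rpow (by positivity) hg
      (fun n => continuous_trigPoly (J n) (a n)) hJa).rpow_const (Or.inr hγ.le)).const_mul _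
  set κ := 2 ^ (-γ) * Real.Gamma (γ + 1)
  have h2 : Tendsto (fun n : ℕ => 2 * (2 * (1 / ((n : ℝ) + 1))) * κ * (δ / 4) ^ (-γ)) atTop
      (𝓝 (2 * (2 * 0) * κ * (δ / 4) ^ (-γ))) :=
    (((tendsto_one_div_add_atTop_nhds_zero_nat.const_mul 2).const_mul 2).mul_const _).mul_const _
  obtain ⟨n, hnU, hn⟩ := ((h1.eventually hU).and (h2.eventually
    (ge_mem_nhds (show 2 * (2 * 0) * κ * (δ / 4) ^ (-γ) < η by simpa using hη)))).exists
  obtain ⟨C, hC, hae⟩ := exists_norm_sub_shiftSymbol_le hφ hγ hlim (by positivity) (hJa n)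
  refine ⟨J n, a n, hnU, ?_⟩
  rw [← toeplitz_sum_smul, ← toeplitz_sub]
  exact eventually_normLEOffDim_toeplitz hγ (by positivity) hC _ hae hδ hn

theorem theorem1p1 (φ : ℂ → ℂ) (hφ : MemLp φ ∞ diskMeasure) (γ : ℝ) (hγ : 0 < γ)
    (φinf : Circle → ℂ) (hcont : Continuous φinf)
    (hlim : TendstoUniformly
      (fun (r : ℝ) (ζ : Circle) => (((1 - r) ^ (-γ) : ℝ) : ℂ) * φ ((r : ℂ) * (ζ : ℂ)))
      φinf (𝓝[<] (1 : ℝ))) :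
    IsCompactOperator (toeplitz hφ.toLp) ∧
    (fun n : ℕ => singularValue (toeplitz hφ.toLp) n - toeplitzCoeff γ φinf * (n : ℝ) ^ (-γ))
      =o[atTop] (fun n : ℕ => (n : ℝ) ^ (-γ)) := by
  have hκ : 0 < (2 : ℝ) ^ (-γ) * Real.Gamma (γ + 1) :=
    mul_pos (by positivity) (Real.Gamma_pos_of_pos (by linarith))
  have hC0 : 0 ≤ toeplitzCoeff γ φinf := by
    rw [toeplitzCoeff_eq]
    have : 0 ≤ circleMean fun ζ => ‖φinf ζ‖ ^ (1 / γ) := circleMean_nonneg fun _ => by positivity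
    positivity
  have hA : ∀ j : ℤ, ∀ k i : ℕ, (k : ℤ) + j = i →
      toeplitz (memLp_shiftSymbol hγ.le j).toLp (bergmanBasis k) =
        (shiftWeight γ j k : ℂ) • bergmanBasis i :=
    fun j k i h => toeplitz_shiftSymbol_bergmanBasis hγ.le j k i h
  have hc := fun j : ℤ => tendsto_shiftWeight_mul_rpow (γ := γ) (by linarith) j
  have hU : ∀ σ, toeplitzCoeff γ φinf < σ →
      ∀ᶠ n : ℕ in atTop, NormLEOffDim (toeplitz hφ.toLp) n (σ * (n : ℝ) ^ (-γ)) := by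
    intro σ hσ
    -- Two margins: the coefficient of `p` stays below `σ₁`, the step to `σ₂` pays for passing from
    -- multiples of `N` to all `n`, and the step to `σ` pays for the approximation of the symbol.
    obtain ⟨σ₂, h2, h2σ⟩ := exists_between hσ
    obtain ⟨σ₁, h1, h12⟩ := exists_between h2
    refine eventually_normLEOffDim_of_approx (hC0.trans h2.le) h2σ (fun δ hδ η hη => ?_) hγ
    obtain ⟨J, a, hJa, happ⟩ :=
      exists_trigPoly_approx_toeplitz hφ hγ hcont hlim (Iio_mem_nhds h1) hδ hη
    obtain ⟨N, hN, hev⟩ := exists_eventually_normLEOffDim bergmanBasis hγ hκ hA hc hJa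
    exact ⟨_, eventually_normLEOffDim_of_multiples hN h12 hev, happ⟩
  have hL : ∀ σ, 0 < σ → σ < toeplitzCoeff γ φinf →
      ∀ᶠ n : ℕ in atTop, NormGEOnDim (toeplitz hφ.toLp) (n + 1) (σ * (n : ℝ) ^ (-γ)) := by
    intro σ hσ0 hσ
    obtain ⟨σ₂, hσ2, h2⟩ := exists_between hσ
    obtain ⟨σ₁, h21, h1⟩ := exists_between h2
    refine eventually_normGEOnDim_of_approx (hσ0.trans hσ2).le hσ2 (fun δ hδ η hη => ?_) hγ
    obtain ⟨J, a, hJa, happ⟩ :=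
      exists_trigPoly_approx_toeplitz hφ hγ hcont hlim (Ioi_mem_nhds h1) hδ hη
    obtain ⟨N, hN, hev⟩ := exists_eventually_normGEOnDim bergmanBasis hγ hκ hA hc
      ((hσ0.trans hσ2).trans h21) hJa
    exact ⟨_, eventually_normGEOnDim_of_multiples hN h21 hev, happ⟩
  exact ⟨isCompactOperator_of_normLEOffDim (forall_exists_normLEOffDim_of_eventually hγ
    (hU (toeplitzCoeff γ φinf + 1) (by linarith))), isLittleO_singularValue hγ hC0 hU hL⟩
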